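/- In the $k$-range-medians problem the input is an unsorted array $S[1..n]$, $n\ge 1$, of distinct elements of a linearly ordered set, together with $k\ge 1$ queries $Q_j=[l_j,r_j]$, $1\le l_j\le r_j\le n$. The answer to $Q_j$ is the median of $\{S[l_j],S[l_j+1],\dots,S[r_j]\}$, that is, its element of rank $\lceil (r_j-l_j+1)/2\rceil$, returned as its position in $S$. The queries arrive online: $Q_{j+1}$ is revealed only after $Q_j$ has been answered. The number $k$ is not known to the algorithm. The model of computation is a unit-cost word RAM in the comparison model: the array elements can only be compared with each other (one step per comparison), and each operation on machine words (addition, truncated subtraction, multiplication, integer division, word comparison, memory access, branch, procedure call) takes one step. Machine words are nonnegative integers at most $(n+k)^{c}$ for an absolute constant $c$, i.e. they have $O(\log (n+k))$ bits; this bound on the words is not visible to the algorithm. Theorem. There are a single deterministic algorithm in this model and absolute constants $C$ and $c$ such that, for every $n\ge 1$, every such array $S$, every $k\ge1$ and every sequence of $k$ queries arriving online, the algorithm, which does not know $k$, answers all $k$ queries correctly, and the total number of steps that it performs, including all preprocessing, is at most $$C\,\bigl(n\log (k+1)+k\log (k+1)\,\log (n+1)\bigr).$$ In particular the total time is $O(n\log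 k+k\log k\log n)$ for $n,k\ge 2$; since this holds for every $k$, it is an amortized bound for the online problem. -/

import Mathlib

/-!
A comparison-based word RAM with unit-cost instructions.

The elements of the input array are opaque: a program reaches them only through the instruction
`less`, which compares two of them, given by their positions.  Everything else a program handles
is a machine word, a natural number at most `W`; an instruction that would produce a larger word
cannot be executed, so a program can neither use larger words nor detect the value of `W`.
-/

namespace RangeMedian

/-- An operand of an instruction: a constant, or the content of a register. -/
inductive Operand where
  | lit (c : ℕ)
  | reg (r : ℕ)

/-- The word operations.  `sub` is truncated, `div` rounds down (with `x / 0 = 0`), and `lt`, `eq`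
return `1` for true and `0` for false. -/
inductive WordOp where
  | add | sub | mul | div | lt | eq

def WordOp.eval : WordOp → ℕ → ℕ → ℕ
  | .add, x, y => x + y
  | .sub, x, y => x - y
  | .mul, x, y => x * y
  | .div, x, y => x / y
  | .lt, x, y => if x < y then 1 else 0
  | .eq, x, y => if x = y then 1 else 0

/-- Programs. -/
inductive Stmt where
  /-- do nothing -/
  | skip
  /-- register `d` becomes `o x y` -/
  | op (d : ℕ) (o : WordOp) (x y : Operand)
  /-- register `d` becomes the content of memory cell `x` -/
  | load (d : ℕ) (x : Operand)
  /-- memory cell `x` becomes `y` -/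
  | store (x y : Operand)
  /-- register `d` becomes `1` if the array element at position `x` is smaller than the one at
  position `y`, and `0` otherwise -/
  | less (d : ℕ) (x y : Operand)
  /-- first `s`, then `t` -/
  | seq (s t : Stmt)
  /-- `s` if `x` is nonzero, else `t` -/
  | cond (x : Operand) (s t : Stmt)
  /-- repeat `s` as long as `x` is nonzero -/
  | loop (x : Operand) (s : Stmt)
  /-- execute the `p`-th procedure; registers and memory are global, recursion is allowed -/
  | call (p : ℕ)

/-- The contents of the registers and of the memory cells. -/
structure State where
  reg : ℕ → ℕ
  mem : ℕ → ℕ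

def State.setReg (σ : State) (r v : ℕ) : State :=
  { σ with reg := Function.update σ.reg r v }

def State.setMem (σ : State) (a v : ℕ) : State :=
  { σ with mem := Function.update σ.mem a v }

def Operand.eval (σ : State) : Operand → ℕ
  | .lit c => c
  | .reg r => σ.reg r

/-- `Exec W procs S s σ t σ'`: with largest word `W`, procedures `procs` and input array `S`, the
program `s` started in state `σ` halts in state `σ'` after `t` steps. Every instruction, every
test of a `cond` or a `loop`, and every procedure call is one step. There is no rule for an
overflow, for a comparison outside the array, or for a call of a missing procedure: such
an execution does not halt properly. -/
inductive Exec {α : Type*} [LinearOrder α] {n : ℕ} (W : ℕ) (procs : List Stmt) (S : Fin n → α) :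
    Stmt → State → ℕ → State → Prop where
  | skip (σ : State) : Exec W procs S .skip σ 1 σ
  | op (σ : State) (d : ℕ) (o : WordOp) (x y : Operand)
      (hW : o.eval (x.eval σ) (y.eval σ) ≤ W) :
      Exec W procs S (.op d o x y) σ 1 (σ.setReg d (o.eval (x.eval σ) (y.eval σ)))
  | load (σ : State) (d : ℕ) (x : Operand) :
      Exec W procs S (.load d x) σ 1 (σ.setReg d (σ.mem (x.eval σ)))
  | store (σ : State) (x y : Operand) (hx : x.eval σ ≤ W) (hy : y.eval σ ≤ W) :
      Exec W procs S (.store x y) σ 1 (σ.setMem (x.eval σ) (y.eval σ))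
  | less (σ : State) (d : ℕ) (x y : Operand) (hx : x.eval σ < n) (hy : y.eval σ < n) :
      Exec W procs S (.less d x y) σ 1
        (σ.setReg d (if S ⟨x.eval σ, hx⟩ < S ⟨y.eval σ, hy⟩ then 1 else 0))
  | seq {s s' : Stmt} {σ σ' σ'' : State} {t t' : ℕ}
      (h : Exec W procs S s σ t σ') (h' : Exec W procs S s' σ' t' σ'') :
      Exec W procs S (.seq s s') σ (t + t') σ''
  | cond_true {x : Operand} {s s' : Stmt} {σ σ' : State} {t : ℕ} (hx : x.eval σ ≠ 0)
      (h : Exec W procs S s σ t σ') : Exec W procs S (.cond x s s') σ (1 + t) σ'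
  | cond_false {x : Operand} {s s' : Stmt} {σ σ' : State} {t : ℕ} (hx : x.eval σ = 0)
      (h : Exec W procs S s' σ t σ') : Exec W procs S (.cond x s s') σ (1 + t) σ'
  | loop_stop {x : Operand} {s : Stmt} {σ : State} (hx : x.eval σ = 0) :
      Exec W procs S (.loop x s) σ 1 σ
  | loop_step {x : Operand} {s : Stmt} {σ σ' σ'' : State} {t t' : ℕ} (hx : x.eval σ ≠ 0)
      (h : Exec W procs S s σ t σ') (h' : Exec W procs S (.loop x s) σ' t' σ'') :
      Exec W procs S (.loop x s) σ (1 + t + t') σ''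
  | call {p : ℕ} {s : Stmt} {σ σ' : State} {t : ℕ} (hp : procs[p]? = some s)
      (h : Exec W procs S s σ t σ') : Exec W procs S (.call p) σ (1 + t) σ'

/-- Execution is deterministic: the initial state determines the number of steps and the final
state. -/
theorem Exec.deterministic {α : Type*} [LinearOrder α] {n W : ℕ} {procs : List Stmt}
    {S : Fin n → α} {s : Stmt} {σ σ₁ σ₂ : State} {t₁ t₂ : ℕ}
    (h₁ : Exec W procs S s σ t₁ σ₁) (h₂ : Exec W procs S s σ t₂ σ₂) : t₁ = t₂ ∧ σ₁ = σ₂ := by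
  induction h₁ generalizing t₂ σ₂ with
  | skip => cases h₂; exact ⟨rfl, rfl⟩
  | op => cases h₂; exact ⟨rfl, rfl⟩
  | load => cases h₂; exact ⟨rfl, rfl⟩
  | store => cases h₂; exact ⟨rfl, rfl⟩
  | less => cases h₂; exact ⟨rfl, rfl⟩
  | seq _ _ ih ih' =>
    cases h₂ with
    | seq g g' =>
      obtain ⟨rfl, rfl⟩ := ih g
      obtain ⟨rfl, rfl⟩ := ih' g'
      exact ⟨rfl, rfl⟩
  | cond_true hx _ ih =>
    cases h₂ with
    | cond_true _ g => obtain ⟨rfl, rfl⟩ := ih g; exact ⟨rfl, rfl⟩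
    | cond_false hx' _ => exact absurd hx' hx
  | cond_false hx _ ih =>
    cases h₂ with
    | cond_true hx' _ => exact absurd hx hx'
    | cond_false _ g => obtain ⟨rfl, rfl⟩ := ih g; exact ⟨rfl, rfl⟩
  | loop_stop hx =>
    cases h₂ with
    | loop_stop => exact ⟨rfl, rfl⟩
    | loop_step hx' _ _ => exact absurd hx hx'
  | loop_step hx _ _ ih ih' =>
    cases h₂ with
    | loop_stop hx' => exact absurd hx' hx
    | loop_step _ g g' =>
      obtain ⟨rfl, rfl⟩ := ih g
      obtain ⟨rfl, rfl⟩ := ih' g'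
      exact ⟨rfl, rfl⟩
  | call hp _ ih =>
    cases h₂ with
    | call hp' g =>
      obtain rfl := Option.some.inj (hp.symm.trans hp')
      obtain ⟨rfl, rfl⟩ := ih g
      exact ⟨rfl, rfl⟩

/-- `x` is the median of the finite set `T`: its element of rank `⌈|T| / 2⌉`. -/
def IsMedian {α : Type*} [LinearOrder α] (T : Finset α) (x : α) : Prop :=
  x ∈ T ∧ (T.filter (fun y => y ≤ x)).card = (T.card + 1) / 2

/-- A query: an interval `[l, r]` of positions of an array of length `n` (counted from `0`). -/
structure Query (n : ℕ) where
  l : Fin n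
  r : Fin n
  le : l ≤ r

/-- The word `v` is a correct answer to the query `q`: the position of the median of
`S[l], …, S[r]`. -/
def IsAnswer {α : Type*} [LinearOrder α] {n : ℕ} (S : Fin n → α) (q : Query n) (v : ℕ) : Prop :=
  ∃ h : v < n, IsMedian ((Finset.Icc q.l q.r).image S) (S ⟨v, h⟩)

/-- An online algorithm: procedures, a program that is run once on the array before the first
query, and a program that is run on each query when it arrives. -/
structure OnlineAlgorithm where
  procs : List Stmt
  preprocess : Stmt
  answer : Stmt

/-- At the start register `0` holds the length of the array; all else is `0`. -/
def startState (n : ℕ) : State :=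
  State.setReg ⟨fun _ => 0, fun _ => 0⟩ 0 n

/-- `A.Answers W S σ qs t`: from state `σ`, the queries `qs` are answered correctly, one after the
other, in `t` steps in total. A query arrives, in registers `0` and `1`, only after the preceding
one has been answered; the answer is returned in register `0`. The rest of the state
persists from one query to the next. -/
inductive OnlineAlgorithm.Answers (A : OnlineAlgorithm) {α : Type*} [LinearOrder α] {n : ℕ}
    (W : ℕ) (S : Fin n → α) : State → List (Query n) → ℕ → Prop where
  | nil (σ : State) : A.Answers W S σ [] 0
  | cons {σ σ' : State} {q : Query n} {qs : List (Query n)} {t t' : ℕ}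
      (hrun : Exec W A.procs S A.answer ((σ.setReg 0 q.l).setReg 1 q.r) t σ')
      (hans : IsAnswer S q (σ'.reg 0))
      (hrest : A.Answers W S σ' qs t') : A.Answers W S σ (q :: qs) (t + t')

/-- `A.Solves W S qs t`: on the array `S`, preprocessing followed by answering the queries `qs`
online, all of them correctly, takes `t` steps in total. -/
def OnlineAlgorithm.Solves (A : OnlineAlgorithm) {α : Type*} [LinearOrder α] {n : ℕ}
    (W : ℕ) (S : Fin n → α) (qs : List (Query n)) (t : ℕ) : Prop :=
  ∃ (σ : State) (t₀ t₁ : ℕ), Exec W A.procs S A.preprocess (startState n) t₀ σ ∧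
    A.Answers W S σ qs t₁ ∧ t = t₀ + t₁

end RangeMedian

/-! Build a balanced binary tree over the ranks `0, …, n - 1` lazily. A node `[a, b)` lists the
positions whose rank lies in `[a, b)`, in increasing order, and stores for every prefix of that list
how many of its positions go to the left child. The positions of a node inside `[l, r]` are
consecutive in its list, so two lookups per level show how many of them go left. A query thus
descends from the root to a leaf in constant time per level, apart from the cost of splitting nodes
met for the first time. Splitting a node of size `s` means selecting the element of its middle rank
by median of medians (`run_select`) and distributing the positions (`run_distribute`); together this
takes `O(s)` steps (`run_split`).

The amortization fixes a depth `D`, namely `⌈log₂ k⌉` capped at `n`. Nodes at depth less than `D`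
are split at most once each and are paid for by a potential, the number of count cells of those
levels that are still zero, initially at most `3nD` (`potential_split`, `potential_le`). A node at
depth `d` has size at most `(n - 1) / 2 ^ d + 1` (`IsNode.size_le`), so the splits of one query at
depth `D` and deeper cost a geometric sum of order `n / 2 ^ D + log n` (`run_search`); over `k`
queries this is `O(n + k log n)`. Since `D` occurs only in the analysis, the algorithm does not need
`k`. The total is `O(n + n log k + k log n)`, slightly better than claimed (`exists_solves`).

Memory consists of `n + 2` levels of `4n` cells, followed by the stack of the selection procedure.
In a level, the first `n` cells hold positions: node `[a, b)` owns offsets `a, …, b - 1`. Its `b - a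
+ 1` counts begin at offset `n + 2a`; the factor two makes room for the extra cell of each node.
Counts are stored increased by one, so that zero means "not yet split". -/

namespace RangeMedian

-- Total-correctness rules for programs, and ranks of array elements.

infixr:60 " ;; " => Stmt.seq

@[simp] theorem State.reg_setReg (σ : State) (r v j : ℕ) :
    (σ.setReg r v).reg j = if j = r then v else σ.reg j := by
  simp [State.setReg, Function.update_apply]

@[simp] theorem State.mem_setReg (σ : State) (r v : ℕ) : (σ.setReg r v).mem = σ.mem := rfl

@[simp] theorem State.reg_setMem (σ : State) (a v : ℕ) : (σ.setMem a v).reg = σ.reg := rfl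

@[simp] theorem State.mem_setMem (σ : State) (a v b : ℕ) :
    (σ.setMem a v).mem b = if b = a then v else σ.mem b := by
  simp [State.setMem, Function.update_apply]

attribute [simp] Operand.eval WordOp.eval

/-- `Run W procs S s σ Q`: from state `σ`, the program `s` halts, after a number of steps and in a
state that satisfy `Q`. -/
def Run {α : Type*} [LinearOrder α] {n : ℕ} (W : ℕ) (procs : List Stmt) (S : Fin n → α)
    (s : Stmt) (σ : State) (Q : ℕ → State → Prop) : Prop :=
  ∃ t σ', Exec W procs S s σ t σ' ∧ Q t σ'

/-- `K` numbers the positions of `S` by increasing content. -/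
structure IsRank {α : Type*} [LinearOrder α] {n : ℕ} (S : Fin n → α) (K : ℕ → ℕ) : Prop where
  lt_iff : ∀ i j : Fin n, S i < S j ↔ K i < K j
  bijOn : Set.BijOn K (Set.Iio n) (Set.Iio n)

/-- Send a position to the number of smaller elements. As `S` is injective, this is an injective map
of an `n`-element set to itself, hence bijective. -/
theorem exists_isRank {α : Type*} [LinearOrder α] {n : ℕ} {S : Fin n → α}
    (hS : Function.Injective S) : ∃ K, IsRank S K := by
  classical
  let f : Fin n → ℕ := fun i => (Finset.univ.filter (fun j => S j < S i)).card
  have hmono : ∀ i j, S i < S j → f i < f j := by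
    intro i j hij
    apply Finset.card_lt_card
    rw [Finset.ssubset_iff_of_subset]
    · exact ⟨i, by simp [hij], by simp⟩
    · intro x hx
      simp only [Finset.mem_filter, Finset.mem_univ, true_and] at hx ⊢
      exact hx.trans hij
  have hiff : ∀ i j, S i < S j ↔ f i < f j := by
    intro i j
    refine ⟨hmono i j, fun h => ?_⟩
    by_contra hc
    rcases (not_lt.1 hc).lt_or_eq with h' | h'
    · exact absurd (hmono j i h') (by omega)
    · rw [hS h'] at h; omega
  have hlt : ∀ i, f i < n := by
    intro i
    have : f i < (Finset.univ : Finset (Fin n)).card := by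
      apply Finset.card_lt_card
      rw [Finset.ssubset_iff_of_subset (Finset.filter_subset _ _)]
      exact ⟨i, by simp, by simp⟩
    simpa using this
  have hinj : Function.Injective (fun i => (⟨f i, hlt i⟩ : Fin n)) := by
    intro i j hij
    have hij' : f i = f j := by simpa using hij
    rcases lt_trichotomy (S i) (S j) with h | h | h
    · have := hmono _ _ h; omega
    · exact hS h
    · have := hmono _ _ h; omega
  have hsurj := Finite.surjective_of_injective hinj
  refine ⟨fun x => if h : x < n then f ⟨x, h⟩ else 0, ?_, ?_, ?_, ?_⟩
  · intro i j
    simpa using hiff i j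
  · intro x hx
    have hx' : x < n := hx
    simpa [hx'] using hlt ⟨x, hx'⟩
  · intro x hx y hy hxy
    have hx' : x < n := hx
    have hy' : y < n := hy
    simp only [hx', hy', dite_true] at hxy
    have := @hinj ⟨x, hx'⟩ ⟨y, hy'⟩ (by simpa using hxy)
    simpa using this
  · intro v hv
    obtain ⟨i, hi⟩ := hsurj ⟨v, hv⟩
    refine ⟨i, i.2, ?_⟩
    simpa using congrArg Fin.val hi

section
variable {α : Type*} [LinearOrder α] {n : ℕ} {W : ℕ} {procs : List Stmt} {S : Fin n → α}

theorem Run.mono {s : Stmt} {σ : State} {Q Q' : ℕ → State → Prop} (h : Run W procs S s σ Q)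
    (hQ : ∀ t σ', Q t σ' → Q' t σ') : Run W procs S s σ Q' := by
  obtain ⟨t, σ', h, h'⟩ := h
  exact ⟨t, σ', h, hQ _ _ h'⟩

@[simp] theorem run_skip {σ : State} {Q : ℕ → State → Prop} :
    Run W procs S .skip σ Q ↔ Q 1 σ := by
  constructor
  · rintro ⟨t, σ', h, h'⟩; cases h; exact h'
  · exact fun h => ⟨_, _, .skip σ, h⟩

@[simp] theorem run_op {σ : State} {Q : ℕ → State → Prop} {d : ℕ} {o : WordOp} {x y : Operand} :
    Run W procs S (.op d o x y) σ Q ↔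
      o.eval (x.eval σ) (y.eval σ) ≤ W ∧ Q 1 (σ.setReg d (o.eval (x.eval σ) (y.eval σ))) := by
  constructor
  · rintro ⟨t, σ', h, h'⟩; cases h with | op _ _ _ _ _ hW => exact ⟨hW, h'⟩
  · exact fun h => ⟨_, _, .op σ d o x y h.1, h.2⟩

@[simp] theorem run_load {σ : State} {Q : ℕ → State → Prop} {d : ℕ} {x : Operand} :
    Run W procs S (.load d x) σ Q ↔ Q 1 (σ.setReg d (σ.mem (x.eval σ))) := by
  constructor
  · rintro ⟨t, σ', h, h'⟩; cases h; exact h'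
  · exact fun h => ⟨_, _, .load σ d x, h⟩

@[simp] theorem run_store {σ : State} {Q : ℕ → State → Prop} {x y : Operand} :
    Run W procs S (.store x y) σ Q ↔
      x.eval σ ≤ W ∧ y.eval σ ≤ W ∧ Q 1 (σ.setMem (x.eval σ) (y.eval σ)) := by
  constructor
  · rintro ⟨t, σ', h, h'⟩; cases h with | store _ _ _ hx hy => exact ⟨hx, hy, h'⟩
  · exact fun h => ⟨_, _, .store σ x y h.1 h.2.1, h.2.2⟩

/-- The only rule through which programs see the array; it replaces elements by their ranks `K`, so
that all correctness arguments for programs become arithmetic of natural numbers. -/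
theorem run_less {K : ℕ → ℕ} (hK : IsRank S K) {σ : State} {Q : ℕ → State → Prop} {d : ℕ}
    {x y : Operand} :
    Run W procs S (.less d x y) σ Q ↔ x.eval σ < n ∧ y.eval σ < n ∧
      Q 1 (σ.setReg d (if K (x.eval σ) < K (y.eval σ) then 1 else 0)) := by
  constructor
  · rintro ⟨t, σ', h, h'⟩
    cases h with
    | less _ _ _ _ hx hy =>
      refine ⟨hx, hy, ?_⟩
      simpa only [hK.lt_iff] using h'
  · rintro ⟨hx, hy, h⟩
    refine ⟨_, _, .less σ d x y hx hy, ?_⟩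
    simpa only [hK.lt_iff] using h

@[simp] theorem run_seq {σ : State} {Q : ℕ → State → Prop} {s s' : Stmt} :
    Run W procs S (.seq s s') σ Q ↔
      Run W procs S s σ (fun t σ' => Run W procs S s' σ' (fun t' σ'' => Q (t + t') σ'')) := by
  constructor
  · rintro ⟨t, σ', h, h'⟩
    cases h with | seq g g' => exact ⟨_, _, g, _, _, g', h'⟩
  · rintro ⟨t, σ', h, t', σ'', h', hQ⟩
    exact ⟨_, _, .seq h h', hQ⟩

@[simp] theorem run_cond {σ : State} {Q : ℕ → State → Prop} {x : Operand} {s s' : Stmt} :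
    Run W procs S (.cond x s s') σ Q ↔
      (x.eval σ ≠ 0 → Run W procs S s σ (fun t σ' => Q (1 + t) σ')) ∧
      (x.eval σ = 0 → Run W procs S s' σ (fun t σ' => Q (1 + t) σ')) := by
  constructor
  · rintro ⟨t, σ', h, h'⟩
    cases h with
    | cond_true hx g => exact ⟨fun _ => ⟨_, _, g, h'⟩, fun h => absurd h hx⟩
    | cond_false hx g => exact ⟨fun h => absurd hx h, fun _ => ⟨_, _, g, h'⟩⟩
  · rintro ⟨h₁, h₂⟩
    by_cases hx : x.eval σ = 0
    · obtain ⟨t, σ', h, h'⟩ := h₂ hx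
      exact ⟨_, _, .cond_false hx h, h'⟩
    · obtain ⟨t, σ', h, h'⟩ := h₁ hx
      exact ⟨_, _, .cond_true hx h, h'⟩

theorem run_loop_exit {σ : State} {Q : ℕ → State → Prop} {x : Operand} {s : Stmt}
    (hx : x.eval σ = 0) (hQ : Q 1 σ) : Run W procs S (.loop x s) σ Q :=
  ⟨_, _, Exec.loop_stop hx, hQ⟩

theorem run_loop_step {σ : State} {Q : ℕ → State → Prop} {x : Operand} {s : Stmt}
    (hx : x.eval σ ≠ 0)
    (h : Run W procs S s σ (fun t σ' => Run W procs S (.loop x s) σ'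
      (fun t' σ'' => Q (1 + t + t') σ''))) : Run W procs S (.loop x s) σ Q := by
  obtain ⟨t, σ', h, t', σ'', h', hQ⟩ := h
  exact ⟨_, _, .loop_step hx h h', hQ⟩

theorem run_call {σ : State} {Q : ℕ → State → Prop} {p : ℕ} {s : Stmt}
    (hp : procs[p]? = some s) (h : Run W procs S s σ (fun t σ' => Q (1 + t) σ')) :
    Run W procs S (.call p) σ Q := by
  obtain ⟨t, σ', h, hQ⟩ := h
  exact ⟨_, _, .call hp h, hQ⟩

/-- For symbolic execution one instruction at a time: the result is named by a closed form `v`,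
which keeps the terms in the register contents from growing. -/
theorem run_op_seq {σ : State} {Q : ℕ → State → Prop} {d : ℕ} {o : WordOp} {x y : Operand}
    {s : Stmt} (v : ℕ) (hv : o.eval (x.eval σ) (y.eval σ) = v) (hW : v ≤ W)
    (h : Run W procs S s (σ.setReg d v) (fun t σ' => Q (1 + t) σ')) :
    Run W procs S (.op d o x y ;; s) σ Q := by
  subst hv
  exact run_seq.2 (run_op.2 ⟨hW, h⟩)

theorem run_load_seq {σ : State} {Q : ℕ → State → Prop} {d : ℕ} {x : Operand} {s : Stmt} (v : ℕ)
    (hv : σ.mem (x.eval σ) = v)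
    (h : Run W procs S s (σ.setReg d v) (fun t σ' => Q (1 + t) σ')) :
    Run W procs S (.load d x ;; s) σ Q := by
  subst hv
  exact run_seq.2 (run_load.2 h)

theorem run_store_seq {σ : State} {Q : ℕ → State → Prop} {x y : Operand} {s : Stmt} (a v : ℕ)
    (ha : x.eval σ = a) (hv : y.eval σ = v) (haW : a ≤ W) (hvW : v ≤ W)
    (h : Run W procs S s (σ.setMem a v) (fun t σ' => Q (1 + t) σ')) :
    Run W procs S (.store x y ;; s) σ Q := by
  subst ha hv
  exact run_seq.2 (run_store.2 ⟨haW, hvW, h⟩)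

theorem run_less_seq {K : ℕ → ℕ} (hK : IsRank S K) {σ : State} {Q : ℕ → State → Prop} {d : ℕ}
    {x y : Operand} {s : Stmt} (u v : ℕ) (hu : x.eval σ = u) (hv : y.eval σ = v) (hun : u < n)
    (hvn : v < n) (h : Run W procs S s (σ.setReg d (if K u < K v then 1 else 0))
      (fun t σ' => Q (1 + t) σ')) :
    Run W procs S (.less d x y ;; s) σ Q := by
  subst hu hv
  exact run_seq.2 ((run_less hK).2 ⟨hun, hvn, h⟩)

theorem run_seq_assoc {s s' s'' : Stmt} {σ : State} {Q : ℕ → State → Prop}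
    (h : Run W procs S (s ;; s' ;; s'') σ Q) : Run W procs S ((s ;; s') ;; s'') σ Q := by
  simpa only [run_seq, add_assoc] using h

/-- The continuation is moved into the branch taken, so that symbolic execution can go on without an
intermediate postcondition. -/
theorem run_cond_seq_true {x : Operand} {s s' s'' : Stmt} {σ : State} {Q : ℕ → State → Prop}
    (hx : x.eval σ ≠ 0) (h : Run W procs S (s ;; s'') σ (fun t σ' => Q (1 + t) σ')) :
    Run W procs S (.cond x s s' ;; s'') σ Q := by
  simp only [run_seq, run_cond]
  refine ⟨fun _ => ?_, fun h' => absurd h' hx⟩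
  simpa only [run_seq, add_assoc] using h

theorem run_cond_seq_false {x : Operand} {s s' s'' : Stmt} {σ : State} {Q : ℕ → State → Prop}
    (hx : x.eval σ = 0) (h : Run W procs S (s' ;; s'') σ (fun t σ' => Q (1 + t) σ')) :
    Run W procs S (.cond x s s' ;; s'') σ Q := by
  simp only [run_seq, run_cond]
  refine ⟨fun h' => absurd hx h', fun _ => ?_⟩
  simpa only [run_seq, add_assoc] using h

/-- A loop whose control register is counted down, with an invariant that depends on it. -/
theorem run_countdown {r : ℕ} {s : Stmt} (Inv : ℕ → State → Prop) (c : ℕ)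
    (hstep : ∀ i σ, σ.reg r = i + 1 → Inv (i + 1) σ →
      Run W procs S s σ (fun t σ' => t ≤ c ∧ σ'.reg r = i ∧ Inv i σ'))
    {m : ℕ} {σ : State} (hm : σ.reg r = m) (h : Inv m σ) :
    Run W procs S (.loop (.reg r) s) σ
      (fun t σ' => t ≤ m * (c + 1) + 1 ∧ σ'.reg r = 0 ∧ Inv 0 σ') := by
  induction m generalizing σ with
  | zero => exact run_loop_exit hm ⟨by omega, hm, h⟩
  | succ m ih =>
    refine run_loop_step (by simp [hm]) ((hstep m σ hm h).mono ?_)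
    rintro t σ' ⟨ht, hr, hI⟩
    refine (ih hr hI).mono ?_
    rintro t' σ'' ⟨ht', hr', hI'⟩
    refine ⟨?_, hr', hI'⟩
    rw [Nat.succ_mul]
    omega

end

end RangeMedian

/-! ### Ranks within a list, and quadratic selection. -/

namespace RangeMedian

/-- The list `L` is stored in memory from address `b` on. -/
def Holds (m : ℕ → ℕ) (b : ℕ) (L : List ℕ) : Prop :=
  ∀ (i : ℕ) (h : i < L.length), m (b + i) = L[i]

/-- The number of elements of `L` whose key is smaller than that of `x`. -/
def below (K : ℕ → ℕ) (L : List ℕ) (x : ℕ) : ℕ := L.countP (fun y => K y < K x)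

/-- Memory below `b` and the registers outside `5, …, 19` are the same in both states. -/
def Keeps (b : ℕ) (σ σ' : State) : Prop :=
  (∀ a < b, σ'.mem a = σ.mem a) ∧ ∀ j, j < 5 ∨ 20 ≤ j → σ'.reg j = σ.reg j

/-- Put in register `11` the number of elements of the array given by registers `5` and `10` that
are smaller than the element in register `12`. -/
def countBelow : Stmt :=
  .loop (.reg 10) (
    .op 10 .sub (.reg 10) (.lit 1) ;; .op 13 .add (.reg 5) (.reg 10) ;; .load 13 (.reg 13) ;;
    .less 13 (.reg 13) (.reg 12) ;; .op 11 .add (.reg 11) (.reg 13))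

/-- Quadratic selection: put in register `8` the element of rank given by register `7` of the array
given by registers `5` and `6`. -/
def bruteSelect : Stmt :=
  .op 9 .add (.reg 6) (.lit 0) ;;
  .loop (.reg 9) (
    .op 9 .sub (.reg 9) (.lit 1) ;; .op 12 .add (.reg 5) (.reg 9) ;; .load 12 (.reg 12) ;;
    .op 11 .add (.lit 0) (.lit 0) ;; .op 10 .add (.reg 6) (.lit 0) ;; countBelow ;;
    .op 13 .eq (.reg 11) (.reg 7) ;;
    .cond (.reg 13) (.op 8 .add (.reg 12) (.lit 0)) .skip)

section
variable {α : Type*} [LinearOrder α] {n : ℕ} {W : ℕ} {procs : List Stmt} {S : Fin n → α}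
  {K : ℕ → ℕ}

theorem ite_one_zero_le {p : Prop} [Decidable p] {m : ℕ} (h : 1 ≤ m) :
    (if p then 1 else 0) ≤ m := by
  split <;> omega

theorem below_le_length (L : List ℕ) (x : ℕ) : below K L x ≤ L.length := List.countP_le_length

theorem below_lt_length {L : List ℕ} {x : ℕ} (hx : x ∈ L) : below K L x < L.length := by
  refine lt_of_le_of_ne (below_le_length L x) fun h => ?_
  have := List.countP_eq_length.1 h x hx
  simp at this

/-- Among the elements with key less than `K y`, the element `x` itself is not below `x`. -/
theorem below_lt_below {L : List ℕ} {x y : ℕ} (hx : x ∈ L) (h : K x < K y) :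
    below K L x < below K L y := by
  have h1 : below K L x ≤ (L.filter (fun z => K z < K y)).countP (fun z => K z < K x) := by
    rw [List.countP_filter]
    refine List.countP_mono_left fun z _ hz => ?_
    simp only [decide_eq_true_eq, Bool.and_eq_true] at hz ⊢
    omega
  have h2 := @below_lt_length K (L.filter (fun z => K z < K y)) x (by simp [hx, h])
  rw [← List.countP_eq_length_filter] at h2
  exact lt_of_le_of_lt h1 h2

/-- By `below_lt_below` the rank map is injective from the elements of `L` to the numbers less than
`L.length`; by cardinality it is onto. -/
theorem exists_below_eq {L : List ℕ} (hL : L.Nodup) (hK : Set.InjOn K {x | x ∈ L}) {r : ℕ}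
    (hr : r < L.length) : ∃ x ∈ L, below K L x = r := by
  have h1 : (L.toFinset.image (below K L)) = Finset.range L.length := by
    apply Finset.eq_of_subset_of_card_le
    · intro v hv
      simp only [Finset.mem_image, List.mem_toFinset] at hv
      obtain ⟨x, hx, rfl⟩ := hv
      exact Finset.mem_range.2 (below_lt_length hx)
    · rw [Finset.card_image_of_injOn, List.toFinset_card_of_nodup hL, Finset.card_range]
      intro x hx y hy hxy
      simp only [List.coe_toFinset, Set.mem_ofPred_eq] at hx hy
      rcases lt_trichotomy (K x) (K y) with h | h | h
      · have := below_lt_below hx h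
        omega
      · exact hK hx hy h
      · have := below_lt_below hy h
        omega
  have h2 : r ∈ L.toFinset.image (below K L) := h1 ▸ Finset.mem_range.2 hr
  simpa using h2

theorem run_countBelow (hK : IsRank S K) {σ : State} {L : List ℕ} {b x : ℕ}
    (h5 : σ.reg 5 = b) (h10 : σ.reg 10 = L.length) (h11 : σ.reg 11 = 0) (h12 : σ.reg 12 = x)
    (hL : Holds σ.mem b L) (hLn : ∀ y ∈ L, y < n) (hx : x < n) (hbW : b + L.length ≤ W) :
    Run W procs S countBelow σ (fun t σ' => t ≤ L.length * 6 + 1 ∧ σ'.reg 11 = below K L x ∧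
      σ'.mem = σ.mem ∧ ∀ j, j ≠ 10 → j ≠ 11 → j ≠ 13 → σ'.reg j = σ.reg j) := by
  -- Loops count down, so what has been processed is a suffix `L.drop i`; the same pattern recurs in
  -- the later loops over lists.
  let Inv : ℕ → State → Prop := fun i σ' => i ≤ L.length ∧ σ'.reg 11 = below K (L.drop i) x ∧
    σ'.mem = σ.mem ∧ ∀ j, j ≠ 10 → j ≠ 11 → j ≠ 13 → σ'.reg j = σ.reg j
  refine (run_countdown Inv 5 ?_ h10 ⟨le_rfl, by simp [h11, below], rfl, fun _ _ _ _ => rfl⟩).mono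
    ?_
  · rintro i τ hi ⟨hle, hc, hm, hr⟩
    have e5 : τ.reg 5 = b := by rw [hr 5 (by omega) (by omega) (by omega), h5]
    have e12 : τ.reg 12 = x := by rw [hr 12 (by omega) (by omega) (by omega), h12]
    have hlt : i < L.length := hle
    have hmi : τ.mem (b + i) = L[i] := by rw [hm]; exact hL i hlt
    have hmem : L[i] < n := hLn _ (List.getElem_mem hlt)
    have hcl := below_le_length (K := K) (L.drop (i + 1)) x
    rw [List.length_drop] at hcl
    have hd : below K (L.drop i) x = below K (L.drop (i + 1)) x + if K L[i] < K x then 1 else 0 := by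
      rw [List.drop_eq_getElem_cons hlt, below, below, List.countP_cons]
      simp
    simp only [run_seq, run_op, run_load, run_less hK]
    simp [hi, e5, e12, hmi, hmem, hx, hc]
    refine ⟨by omega, by omega, ?_, by omega, hd.symm, hm, ?_⟩
    · split <;> omega
    · intro j h1 h2 h3
      simp [h1, h2, h3, hr]
  · rintro t σ' ⟨ht, _, _, hc, hm, hr⟩
    exact ⟨ht, by simpa using hc, hm, hr⟩

theorem run_bruteSelect (hK : IsRank S K) {σ : State} {L : List ℕ} {b r : ℕ}
    (h5 : σ.reg 5 = b) (h6 : σ.reg 6 = L.length) (h7 : σ.reg 7 = r)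
    (hL : Holds σ.mem b L) (hLn : ∀ y ∈ L, y < n) (hnd : L.Nodup) (hr : r < L.length)
    (hbW : b + L.length ≤ W) (hnW : n ≤ W) (hW : 16 ≤ W) :
    Run W procs S bruteSelect σ (fun t σ' => t ≤ L.length * (L.length * 6 + 12) + 2 ∧
      σ'.reg 8 ∈ L ∧ below K L (σ'.reg 8) = r ∧ σ'.mem = σ.mem ∧
      ∀ j, j < 8 ∨ 14 ≤ j → σ'.reg j = σ.reg j) := by
  -- Register `8` is arbitrary until a candidate of rank `r` has been met, hence the implication;
  -- `exists_below_eq` supplies its premise at the end, when the suffix is all of `L`.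
  let Inv : ℕ → State → Prop := fun i σ' => i ≤ L.length ∧
    ((∃ x ∈ L.drop i, below K L x = r) → σ'.reg 8 ∈ L ∧ below K L (σ'.reg 8) = r) ∧
    σ'.mem = σ.mem ∧ ∀ j, j < 8 ∨ 14 ≤ j → σ'.reg j = σ.reg j
  have hloop := fun τ (h9 : τ.reg 9 = L.length) (hI : Inv L.length τ) =>
    run_countdown (W := W) (procs := procs) (S := S) (r := 9) (s :=
    .op 9 .sub (.reg 9) (.lit 1) ;; .op 12 .add (.reg 5) (.reg 9) ;; .load 12 (.reg 12) ;;
    .op 11 .add (.lit 0) (.lit 0) ;; .op 10 .add (.reg 6) (.lit 0) ;; countBelow ;;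
    .op 13 .eq (.reg 11) (.reg 7) ;;
    .cond (.reg 13) (.op 8 .add (.reg 12) (.lit 0)) .skip) Inv (L.length * 6 + 9) ?_ h9 hI
  · simp only [bruteSelect, run_seq, run_op]
    refine ⟨by simp [h6]; omega, (hloop _ (by simp [h6]) ?_).mono ?_⟩
    · refine ⟨le_rfl, by simp, by simp, fun j hj => ?_⟩
      simp only [State.reg_setReg]
      rw [if_neg (by omega)]
    · rintro t σ' ⟨ht, _, _, h8, hm, hreg⟩
      obtain ⟨h8a, h8b⟩ := h8 (by
        simpa using exists_below_eq hnd (hK.bijOn.injOn.mono (fun x hx => hLn x hx)) hr)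
      refine ⟨?_, h8a, h8b, hm, hreg⟩
      have : L.length * (L.length * 6 + 9 + 1) ≤ L.length * (L.length * 6 + 12) :=
        Nat.mul_le_mul_left _ (by omega)
      omega
  · rintro i τ hi ⟨hle, hc, hm, hreg⟩
    have e5 : τ.reg 5 = b := by rw [hreg 5 (by omega), h5]
    have e6 : τ.reg 6 = L.length := by rw [hreg 6 (by omega), h6]
    have e7 : τ.reg 7 = r := by rw [hreg 7 (by omega), h7]
    have hlt : i < L.length := hle
    have hmi : τ.mem (b + i) = L[i] := by rw [hm]; exact hL i hlt
    have hmem : L[i] < n := hLn _ (List.getElem_mem hlt)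
    rw [run_seq, run_op, run_seq, run_op, run_seq, run_load, run_seq, run_op, run_seq, run_op,
      run_seq]
    refine ⟨by simp [hi]; omega, by simp [hi, e5]; omega, by simp, by simp [e6]; omega, ?_⟩
    refine (run_countBelow hK (L := L) (b := b) (x := L[i]) (by simp [e5]) (by simp [e6]) (by simp)
      (by simp [hi, e5, hmi]) (by simpa [hm] using hL) hLn hmem hbW).mono ?_
    rintro t σ' ⟨ht, h11, hm', hr'⟩
    have f7 : σ'.reg 7 = r := by rw [hr' 7 (by omega) (by omega) (by omega)]; simp [e7]
    have f12 : σ'.reg 12 = L[i] := by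
      rw [hr' 12 (by omega) (by omega) (by omega)]; simp [hi, e5, hmi]
    have f8 : σ'.reg 8 = τ.reg 8 := by rw [hr' 8 (by omega) (by omega) (by omega)]; simp
    have f9 : σ'.reg 9 = i := by rw [hr' 9 (by omega) (by omega) (by omega)]; simp [hi]
    have hreg' : ∀ j, j < 8 ∨ 14 ≤ j → σ'.reg j = σ.reg j := by
      intro j hj
      rw [hr' j (by omega) (by omega) (by omega), ← hreg j hj]
      simp only [State.reg_setReg]
      repeat rw [if_neg (by omega)]
    have hm'' : σ'.mem = σ.mem := by rw [hm', ← hm]; simp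
    simp only [run_seq, run_op, run_cond, run_skip]
    simp only [WordOp.eval, Operand.eval, State.reg_setReg]
    refine ⟨ite_one_zero_le (by omega), fun hne => ⟨by simp [f12]; omega, by omega, by simp [f9], hlt.le,
      ?_, hm'', ?_⟩, fun heq => ⟨by omega, by simp [f9], hlt.le, ?_, hm'', ?_⟩⟩
    · intro _
      have : below K L L[i] = r := by
        by_contra hcon
        simp [h11, f7, hcon] at hne
      simp [f12, this]
    · intro j hj
      simp only [State.reg_setReg]
      rw [if_neg (by omega), if_neg (by omega), hreg' j hj]
    · rintro ⟨x, hx, hxr⟩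
      rw [List.drop_eq_getElem_cons hlt, List.mem_cons] at hx
      rcases hx with rfl | hx
      · simp [h11, f7, hxr] at heq
      · simpa [f8] using hc ⟨x, hx, hxr⟩
    · intro j hj
      simp only [State.reg_setReg]
      rw [if_neg (by omega), hreg' j hj]

end

end RangeMedian

/-! ### Partition around a pivot, and medians of groups of five. -/

namespace RangeMedian

/-- The number of elements of `L` whose key is larger than that of `x`. -/
def above (K : ℕ → ℕ) (L : List ℕ) (x : ℕ) : ℕ := L.countP (fun y => K x < K y)

/-- Whether `u` lies on the low side (for `b = true`) or on the high side of the pivot `q`. -/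
def side (K : ℕ → ℕ) (q : ℕ) (b : Bool) (u : ℕ) : Bool :=
  if b then decide (K u < K q) else decide (K q < K u)

/-- Write the elements on one side of the pivot in register `8` of the array given by registers `5`
and `6` to the stack; their number goes to register `10`. -/
def filterPass (b : Bool) : Stmt :=
  .op 9 .add (.reg 6) (.lit 0) ;; .op 10 .add (.lit 0) (.lit 0) ;;
  .loop (.reg 9) (
    .op 9 .sub (.reg 9) (.lit 1) ;; .op 11 .add (.reg 5) (.reg 9) ;; .load 11 (.reg 11) ;;
    (if b then .less 12 (.reg 11) (.reg 8) else .less 12 (.reg 8) (.reg 11)) ;;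
    .cond (.reg 12)
      (.op 13 .add (.reg 4) (.reg 10) ;; .store (.reg 13) (.reg 11) ;;
        .op 10 .add (.reg 10) (.lit 1))
      .skip)

/-- Write the medians of the groups of five of an array to the stack, from its fourth cell on. The
array starts at the address in register `15`; register `14` holds the number of groups. -/
def medians : Stmt :=
  .loop (.reg 14) (
    .op 14 .sub (.reg 14) (.lit 1) ;; .op 5 .mul (.lit 5) (.reg 14) ;;
    .op 5 .add (.reg 5) (.reg 15) ;; bruteSelect ;; .op 13 .add (.reg 4) (.reg 14) ;;
    .op 13 .add (.reg 13) (.lit 3) ;; .store (.reg 13) (.reg 8))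

/-- `M` represents every third of `A`: it is a sublist, and each side of any element contains at
least three times as many elements of `A` as of `M`. -/
structure Represents (K : ℕ → ℕ) (A M : List ℕ) : Prop where
  sublist : M.Sublist A
  below_le : ∀ q, 3 * below K M q ≤ below K A q
  above_le : ∀ q, 3 * above K M q ≤ above K A q

section
variable {α : Type*} [LinearOrder α] {n : ℕ} {W : ℕ} {procs : List Stmt} {S : Fin n → α}
  {K : ℕ → ℕ}

theorem above_lt_above {L : List ℕ} {x y : ℕ} (hx : x ∈ L) (h : K y < K x) :
    above K L x < above K L y := by
  have h1 : above K L x ≤ (L.filter (fun z => K y < K z)).countP (fun z => K x < K z) := by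
    rw [List.countP_filter]
    refine List.countP_mono_left fun z _ hz => ?_
    simp only [decide_eq_true_eq, Bool.and_eq_true] at hz ⊢
    omega
  have h2 : (L.filter (fun z => K y < K z)).countP (fun z => K x < K z) <
      (L.filter (fun z => K y < K z)).length := by
    refine lt_of_le_of_ne List.countP_le_length fun h' => ?_
    have := List.countP_eq_length.1 h' x (by simp [hx, h])
    simp at this
  rw [← List.countP_eq_length_filter] at h2
  exact lt_of_le_of_lt h1 h2

/-- The summand `1` is `x` itself: keys are injective on `L`, so no other element shares its key,
and `x` occurs only once. -/
theorem below_add_above {L : List ℕ} (hL : L.Nodup) (hK : Set.InjOn K {x | x ∈ L}) {x : ℕ}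
    (hx : x ∈ L) : below K L x + above K L x + 1 = L.length := by
  have h1 : L.countP (fun y => !decide (K y < K x)) =
      above K L x + L.countP (fun y => y = x) := by
    have : ∀ A : List ℕ, (∀ y ∈ A, y ∈ L) → A.countP (fun y => !decide (K y < K x)) =
        above K A x + A.countP (fun y => y = x) := by
      intro A hA
      induction A with
      | nil => rfl
      | cons y A ih =>
        have hy := hA y (by simp)
        have := ih fun z hz => hA z (by simp [hz])
        simp only [above, List.countP_cons] at this ⊢
        rw [this]
        rcases lt_trichotomy (K y) (K x) with h | h | h
        · have hne : y ≠ x := fun e => by rw [e] at h; omega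
          simp [h, hne, h.le]
        · have he : y = x := hK hy hx h
          simp [he]; omega
        · have hne : y ≠ x := fun e => by rw [e] at h; omega
          simp [h, hne, h.le]; omega
    exact this L fun _ h => h
  have h2 : L.countP (fun y => y = x) = 1 := by
    have := List.count_eq_one_of_mem hL hx
    rw [List.count] at this
    rw [← this]
    congr 1
  have h3 := List.length_eq_countP_add_countP (fun y => decide (K y < K x)) (l := L)
  simp only [Bool.not_eq_true, decide_eq_false_iff_not] at h3
  rw [below, h3]
  have : L.countP (fun a => decide ¬K a < K x) = L.countP (fun y => !decide (K y < K x)) := by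
    congr 1; funext a; simp only [decide_not]
  omega

/-- If the median `c` of a group of five lies below `q`, then so do the two elements below `c`,
which makes three elements of the group; symmetrically above. -/
theorem Represents.cons {A M C : List ℕ} (h : Represents K A M) {c : ℕ} (hc : c ∈ C)
    (hlow : below K C c = 2) (hhigh : above K C c = 2) : Represents K (C ++ A) (c :: M) := by
  refine ⟨?_, fun q => ?_, fun q => ?_⟩
  · exact (List.singleton_sublist.2 hc).append h.sublist
  · have := h.below_le q
    have h' : K c < K q → below K C c < below K C q := below_lt_below hc
    simp only [below, List.countP_append, List.countP_cons, decide_eq_true_eq] at *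
    split
    · have := h' ‹_›; omega
    · omega
  · have := h.above_le q
    have h' : K q < K c → above K C c < above K C q := above_lt_above hc
    simp only [above, List.countP_append, List.countP_cons, decide_eq_true_eq] at *
    split
    · have := h' ‹_›; omega
    · omega

theorem Holds.congr {m m' : ℕ → ℕ} {b : ℕ} {L : List ℕ} (h : Holds m b L)
    (hm : ∀ a, b ≤ a → a < b + L.length → m' a = m a) : Holds m' b L := fun i hi => by
  rw [hm _ (by omega) (by omega), h i hi]

theorem Holds.drop {m : ℕ → ℕ} {b : ℕ} {L : List ℕ} (h : Holds m b L) (i : ℕ) :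
    Holds m (b + i) (L.drop i) := fun j hj => by
  rw [List.length_drop] at hj
  rw [List.getElem_drop, add_assoc, h (i + j) (by omega)]

theorem Holds.take {m : ℕ → ℕ} {b : ℕ} {L : List ℕ} (h : Holds m b L) (i : ℕ) :
    Holds m b (L.take i) := fun j hj => by
  rw [List.length_take] at hj
  rw [List.getElem_take, h j (by omega)]

theorem Holds.concat {m : ℕ → ℕ} {b : ℕ} {L : List ℕ} (h : Holds m b L) {x : ℕ}
    (hx : m (b + L.length) = x) : Holds m b (L ++ [x]) := fun j hj => by
  rw [List.length_append, List.length_singleton] at hj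
  by_cases hj' : j < L.length
  · rw [List.getElem_append_left hj', h j hj']
  · obtain rfl : j = L.length := by omega
    simpa using hx

theorem Holds.cons {m : ℕ → ℕ} {b : ℕ} {L : List ℕ} (h : Holds m (b + 1) L) {x : ℕ}
    (hx : m b = x) : Holds m b (x :: L) := fun j hj => by
  cases j with
  | zero => simpa using hx
  | succ j =>
    rw [List.getElem_cons_succ, ← h j (by simpa using hj)]
    congr 1
    omega

theorem run_less_side (hK : IsRank S K) {b : Bool} {σ : State} {Q : ℕ → State → Prop}
    (h1 : σ.reg 11 < n) (h2 : σ.reg 8 < n)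
    (hQ : Q 1 (σ.setReg 12 (if side K (σ.reg 8) b (σ.reg 11) then 1 else 0))) :
    Run W procs S (if b then .less 12 (.reg 11) (.reg 8) else .less 12 (.reg 8) (.reg 11)) σ Q := by
  cases b
  · by_cases h : K (σ.reg 8) < K (σ.reg 11) <;> simpa [run_less hK, h1, h2, side, h] using hQ
  · by_cases h : K (σ.reg 11) < K (σ.reg 8) <;> simpa [run_less hK, h1, h2, side, h] using hQ

theorem run_filterPass (hK : IsRank S K) {σ : State} {L : List ℕ} {a sp q : ℕ} (b : Bool)
    (h4 : σ.reg 4 = sp) (h5 : σ.reg 5 = a) (h6 : σ.reg 6 = L.length) (h8 : σ.reg 8 = q)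
    (hL : Holds σ.mem a L) (hLn : ∀ y ∈ L, y < n) (hq : q < n) (hsp : a + L.length ≤ sp)
    (hspW : sp + L.length + 1 ≤ W) (hnW : n ≤ W) :
    Run W procs S (filterPass b) σ (fun t σ' => t ≤ L.length * 9 + 3 ∧
      σ'.reg 10 = (L.filter (side K q b)).length ∧
      Holds σ'.mem sp (L.filter (side K q b)).reverse ∧
      (∀ x < sp, σ'.mem x = σ.mem x) ∧ ∀ j, j < 9 ∨ 14 ≤ j → σ'.reg j = σ.reg j) := by
  -- The scan runs from the end while the output grows upwards, so the selected elements appear in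
  -- reverse order.
  let Inv : ℕ → State → Prop := fun i σ' => i ≤ L.length ∧
    σ'.reg 10 = ((L.drop i).filter (side K q b)).length ∧
    Holds σ'.mem sp ((L.drop i).filter (side K q b)).reverse ∧
    (∀ x < sp, σ'.mem x = σ.mem x) ∧ ∀ j, j < 9 ∨ 14 ≤ j → σ'.reg j = σ.reg j
  have hloop := fun τ (h9 : τ.reg 9 = L.length) (hI : Inv L.length τ) =>
    run_countdown (W := W) (procs := procs) (S := S) (r := 9) (s :=
    .op 9 .sub (.reg 9) (.lit 1) ;; .op 11 .add (.reg 5) (.reg 9) ;; .load 11 (.reg 11) ;;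
    (if b then .less 12 (.reg 11) (.reg 8) else .less 12 (.reg 8) (.reg 11)) ;;
    .cond (.reg 12)
      (.op 13 .add (.reg 4) (.reg 10) ;; .store (.reg 13) (.reg 11) ;;
        .op 10 .add (.reg 10) (.lit 1))
      .skip) Inv 8 ?_ h9 hI
  · simp only [filterPass, run_seq, run_op]
    refine ⟨by simp [h6]; omega, by simp, (hloop _ (by simp [h6]) ?_).mono ?_⟩
    · refine ⟨le_rfl, by simp, ?_, by simp, fun j hj => ?_⟩
      · intro i hi
        simp at hi
      · simp only [State.reg_setReg]
        repeat rw [if_neg (by omega)]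
    · rintro t σ' ⟨ht, _, _, h10, hH, hm, hreg⟩
      refine ⟨by omega, by simpa using h10, by simpa using hH, hm, hreg⟩
  · rintro i τ hi ⟨hle, hc, hH, hm, hreg⟩
    have e4 : τ.reg 4 = sp := by rw [hreg 4 (by omega), h4]
    have e5 : τ.reg 5 = a := by rw [hreg 5 (by omega), h5]
    have e8 : τ.reg 8 = q := by rw [hreg 8 (by omega), h8]
    have hlt : i < L.length := hle
    have hmi : τ.mem (a + i) = L[i] := by rw [hm _ (by omega)]; exact hL i hlt
    have hmem : L[i] < n := hLn _ (List.getElem_mem hlt)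
    have hcl := List.length_filter_le (side K q b) (L.drop (i + 1))
    rw [List.length_drop, ← hc] at hcl
    have hd : (L.drop i).filter (side K q b) =
        if side K q b L[i] then L[i] :: (L.drop (i + 1)).filter (side K q b)
        else (L.drop (i + 1)).filter (side K q b) := by
      rw [List.drop_eq_getElem_cons hlt, List.filter_cons]
    rw [run_seq, run_op, run_seq, run_op, run_seq, run_load, run_seq]
    refine ⟨by simp [hi]; omega, by simp [hi, e5]; omega, ?_⟩
    refine run_less_side hK (by simpa [hi, e5, hmi]) (by simpa [e8]) ?_
    by_cases hs : side K q b L[i]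
    · rw [if_pos hs] at hd
      simp [hi, e5, e8, hmi, e4, hs, -List.drop_eq_nil_iff]
      refine ⟨by omega, by omega, by omega, hlt.le, by simp [hd, hc], ?_, ?_, ?_⟩
      · rw [hd, List.reverse_cons]
        refine Holds.concat (Holds.congr hH fun x hx hx' => ?_) ?_
        · rw [List.length_reverse, ← hc] at hx'
          simp [show x ≠ sp + τ.reg 10 by omega]
        · simp [hc]
      · intro x hx
        simp [show x ≠ sp + τ.reg 10 by omega, hm x hx]
      · intro j hj
        rw [← hreg j hj]
        simp [show j ≠ 10 by omega, show j ≠ 13 by omega, show j ≠ 12 by omega,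
          show j ≠ 11 by omega, show j ≠ 9 by omega]
    · rw [if_neg hs] at hd
      simp [hi, e5, e8, hmi, e4, hs, -List.drop_eq_nil_iff]
      refine ⟨hlt.le, by simp [hd, hc], by rw [hd]; exact hH, hm, ?_⟩
      intro j hj
      rw [← hreg j hj]
      simp [show j ≠ 12 by omega, show j ≠ 11 by omega, show j ≠ 9 by omega]

theorem run_medians (hK : IsRank S K) {σ : State} {L : List ℕ} {a sp m : ℕ}
    (h4 : σ.reg 4 = sp) (h6 : σ.reg 6 = 5) (h7 : σ.reg 7 = 2) (h14 : σ.reg 14 = m)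
    (h15 : σ.reg 15 = a) (hL : Holds σ.mem a L) (hLn : ∀ y ∈ L, y < n) (hnd : L.Nodup)
    (hm : 5 * m ≤ L.length) (hsp : a + L.length ≤ sp)
    (hspW : sp + L.length + 3 ≤ W) (hnW : n ≤ W) (hW : 16 ≤ W) :
    Run W procs S medians σ (fun t σ' => t ≤ m * 219 + 1 ∧
      (∃ M, Holds σ'.mem (sp + 3) M ∧ M.length = m ∧ Represents K L M) ∧
      (∀ x < sp + 3, σ'.mem x = σ.mem x) ∧
      ∀ j, j < 5 ∨ 15 ≤ j → σ'.reg j = σ.reg j) := by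
  let Inv : ℕ → State → Prop := fun g σ' => g ≤ m ∧
    (∃ M, Holds σ'.mem (sp + 3 + g) M ∧ g + M.length = m ∧ Represents K (L.drop (5 * g)) M) ∧
    (∀ x < sp + 3, σ'.mem x = σ.mem x) ∧
    ∀ j, j < 5 ∨ j = 6 ∨ j = 7 ∨ 15 ≤ j → σ'.reg j = σ.reg j
  -- Per group: `5 * (5 * 6 + 12) + 2 = 212` steps for `bruteSelect` and six other instructions. The
  -- start is the leftover `L.drop (5 * m)`, which the empty list represents trivially; groups are
  -- then added from last to first.
  refine (run_countdown Inv 218 ?_ h14 ⟨le_rfl, ⟨[], ?_, by simp, ?_⟩, by simp, by simp⟩).mono ?_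
  · rintro g τ hg ⟨hle, ⟨M, hM, hMl, hR⟩, hmem, hreg⟩
    have e4 : τ.reg 4 = sp := by rw [hreg 4 (by omega), h4]
    have e6 : τ.reg 6 = 5 := by rw [hreg 6 (by omega), h6]
    have e7 : τ.reg 7 = 2 := by rw [hreg 7 (by omega), h7]
    have e15 : τ.reg 15 = a := by rw [hreg 15 (by omega), h15]
    have hCl : ((L.drop (5 * g)).take 5).length = 5 := by simp; omega
    have hCL : ∀ y ∈ (L.drop (5 * g)).take 5, y ∈ L := fun y hy =>
      List.mem_of_mem_drop (List.mem_of_mem_take hy)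
    have hCnd : ((L.drop (5 * g)).take 5).Nodup :=
      (hnd.sublist (List.drop_sublist _ _)).sublist (List.take_sublist _ _)
    have hτL : Holds τ.mem a L := hL.congr fun x _ hx => hmem x (by omega)
    have hC : Holds τ.mem (5 * g + a) ((L.drop (5 * g)).take 5) := by
      rw [add_comm]
      exact (hτL.drop _).take 5
    have hsplit : L.drop (5 * g) = (L.drop (5 * g)).take 5 ++ L.drop (5 * (g + 1)) := by
      conv_lhs => rw [← List.take_append_drop 5 (L.drop (5 * g))]
      rw [List.drop_drop]
      rfl
    generalize (L.drop (5 * g)).take 5 = C at *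
    rw [run_seq, run_op, run_seq, run_op, run_seq, run_op, run_seq]
    refine ⟨by simp [hg]; omega, by simp [hg]; omega, by simp [hg, e15]; omega, ?_⟩
    refine (run_bruteSelect hK (L := C) (b := 5 * g + a) (r := 2) (by simp [hg, e15])
      (by simp [e6, hCl]) (by simp [e7]) (by simpa using hC) (fun y hy => hLn y (hCL y hy)) hCnd
      (by omega) (by omega) hnW hW).mono ?_
    rintro t σ' ⟨ht, h8, h8', hm', hr'⟩
    rw [hCl] at ht
    have f4 : σ'.reg 4 = sp := by rw [hr' 4 (by omega)]; simp [e4]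
    have f14 : σ'.reg 14 = g := by rw [hr' 14 (by omega)]; simp [hg]
    have hreg' : ∀ j, j < 5 ∨ j = 6 ∨ j = 7 ∨ 15 ≤ j → σ'.reg j = σ.reg j := by
      intro j hj
      rw [hr' j (by omega), ← hreg j hj]
      simp [show j ≠ 5 by omega, show j ≠ 14 by omega]
    have hm'' : σ'.mem = τ.mem := by rw [hm']; simp
    have hab := below_add_above hCnd
      (hK.bijOn.injOn.mono (fun x hx => hLn x (hCL x hx))) h8
    have h8n := hLn _ (hCL _ h8)
    clear hm' hr'
    simp [f4, f14]
    refine ⟨by omega, by omega, by omega, by omega, by omega, ⟨σ'.reg 8 :: M, ?_, ?_, ?_⟩, ?_, ?_⟩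
    · refine Holds.cons (hM.congr fun x hx _ => ?_) ?_
      · simp [show x ≠ sp + g + 3 by omega, hm'']
      · simp [show sp + 3 + g = sp + g + 3 by omega]
    · simp; omega
    · rw [hsplit]
      exact hR.cons h8 h8' (by omega)
    · intro x hx
      simp [show x ≠ sp + g + 3 by omega, hm'', hmem x hx]
    · intro j hj
      simp [show j ≠ 13 by omega, hreg' j hj]
  · intro i hi
    simp at hi
  · exact ⟨by simp, by simp [below], by simp [above]⟩
  · rintro t σ' ⟨ht, _, _, ⟨M, hM, hMl, hR⟩, hmem, hreg⟩
    exact ⟨ht, ⟨M, by simpa using hM, by omega, by simpa using hR⟩, hmem,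
      fun j hj => hreg j (by omega)⟩

end

end RangeMedian

/-! ### Linear-time selection by median of medians. -/

namespace RangeMedian

/-- Call the selection procedure with a new stack frame. -/
def pushCall : Stmt :=
  .op 4 .add (.reg 4) (.reg 3) ;; .call 0 ;; .op 4 .sub (.reg 4) (.reg 3)

/-- Select from the array on top of the stack. -/
def selectTop : Stmt :=
  .op 5 .add (.reg 4) (.lit 0) ;; .op 6 .add (.reg 10) (.lit 0) ;; pushCall

/-- Select by partitioning around the pivot in register `8`. -/
def selectByPivot : Stmt :=
  filterPass true ;; .op 16 .lt (.reg 7) (.reg 10) ;;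
  .cond (.reg 16) selectTop (
    .op 7 .sub (.reg 7) (.reg 10) ;;
    .cond (.reg 7) (.op 7 .sub (.reg 7) (.lit 1) ;; filterPass false ;; selectTop) .skip)

/-- Selection with the median of medians as pivot: put in register `8` the element of rank given by
register `7` of the array given by registers `5` and `6`.  Register `4` is the stack pointer,
register `3` the size of a stack frame. -/
def select : Stmt :=
  .op 16 .lt (.reg 6) (.lit 60) ;;
  .cond (.reg 16) bruteSelect (
    .store (.reg 4) (.reg 5) ;; .op 13 .add (.reg 4) (.lit 1) ;; .store (.reg 13) (.reg 6) ;;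
    .op 13 .add (.reg 4) (.lit 2) ;; .store (.reg 13) (.reg 7) ;;
    .op 15 .add (.reg 5) (.lit 0) ;; .op 16 .div (.reg 6) (.lit 5) ;;
    .op 14 .add (.reg 16) (.lit 0) ;; .op 6 .add (.lit 5) (.lit 0) ;;
    .op 7 .add (.lit 2) (.lit 0) ;; medians ;;
    .op 5 .add (.reg 4) (.lit 3) ;; .op 6 .add (.reg 16) (.lit 0) ;;
    .op 7 .div (.reg 16) (.lit 2) ;; pushCall ;;
    .load 5 (.reg 4) ;; .op 13 .add (.reg 4) (.lit 1) ;; .load 6 (.reg 13) ;;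
    .op 13 .add (.reg 4) (.lit 2) ;; .load 7 (.reg 13) ;; selectByPivot)

/-- The situation in which selection of the element of rank `r` of `L` may be called: the array is
stored from `a` on, free memory begins at `sp`, and frames have size `F`. -/
structure SelectPre (n W : ℕ) (L : List ℕ) (a r sp F : ℕ) (σ : State) : Prop where
  reg3 : σ.reg 3 = F
  reg4 : σ.reg 4 = sp
  reg5 : σ.reg 5 = a
  reg6 : σ.reg 6 = L.length
  reg7 : σ.reg 7 = r
  lt : r < L.length
  holds : Holds σ.mem a L
  lt_n : ∀ y ∈ L, y < n
  nodup : L.Nodup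
  le_sp : a + L.length ≤ sp
  le_F : n + 3 ≤ F
  le_W : sp + (L.length + 1) * F ≤ W
  W_ge : 16 ≤ W

/-- The outcome of selection. -/
structure SelectPost (K : ℕ → ℕ) (L : List ℕ) (r sp : ℕ) (σ σ' : State) : Prop where
  mem : σ'.reg 8 ∈ L
  below_eq : below K L (σ'.reg 8) = r
  keeps : Keeps sp σ σ'

section
variable {α : Type*} [LinearOrder α] {n : ℕ} {W : ℕ} {procs : List Stmt} {S : Fin n → α}
  {K : ℕ → ℕ}

theorem Keeps.trans {b c : ℕ} {σ σ' σ'' : State} (h : Keeps b σ σ') (h' : Keeps c σ' σ'')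
    (hbc : b ≤ c) : Keeps b σ σ'' :=
  ⟨fun a ha => by rw [h'.1 a (by omega), h.1 a ha], fun j hj => by rw [h'.2 j hj, h.2 j hj]⟩

theorem length_le_of_nodup {L : List ℕ} (hL : L.Nodup) (h : ∀ y ∈ L, y < n) : L.length ≤ n := by
  rw [← List.toFinset_card_of_nodup hL, ← Finset.card_range n]
  refine Finset.card_le_card fun y hy => ?_
  simpa using h y (by simpa using hy)

/-- Everything below `x` is also below the pivot, so discarding the rest does not change the rank of
`x`. -/
theorem below_filter_low (L : List ℕ) {q x : ℕ} (h : K x ≤ K q) :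
    below K (L.filter (side K q true)) x = below K L x := by
  rw [below, List.countP_filter, below]
  refine List.countP_congr fun y _ => ?_
  simp only [side]
  simp
  omega

/-- Passing to the high side lowers the rank of `x` by the number of discarded elements, `L.length -
above K L q`, all of which lie below `x`. The form as a sum avoids subtraction. -/
theorem below_filter_high (L : List ℕ) {q x : ℕ} (h : K q < K x) :
    below K L x + above K L q = below K (L.filter (side K q false)) x + L.length := by
  induction L with
  | nil => rfl
  | cons y L ih =>
    simp only [below, above, side, List.countP_cons, List.filter_cons, List.length_cons] at ih ⊢
    by_cases h1 : K q < K y <;> by_cases h2 : K y < K x <;> simp [h1, h2] at ih ⊢ <;> omega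

theorem length_filter_side_true (L : List ℕ) (q : ℕ) :
    (L.filter (side K q true)).length = below K L q := by
  rw [← List.countP_eq_length_filter]
  rfl

theorem length_filter_side_false (L : List ℕ) (q : ℕ) :
    (L.filter (side K q false)).length = above K L q := by
  rw [← List.countP_eq_length_filter]
  rfl

theorem below_reverse (L : List ℕ) (x : ℕ) : below K L.reverse x = below K L x := by
  simp [below]

/-- The callee preserves registers `3` and `4`, so subtracting the frame size restores the stack
pointer, and everything below `sp + F`, including the caller's frame, survives. -/
theorem run_pushCall {L : List ℕ} {a r sp F T : ℕ} {σ : State}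
    (hcall : ∀ τ, SelectPre n W L a r (sp + F) F τ →
      Run W procs S (.call 0) τ (fun t σ' => t ≤ T ∧ SelectPost K L r (sp + F) τ σ'))
    (h4 : σ.reg 4 = sp) (hpre : SelectPre n W L a r (sp + F) F (σ.setReg 4 (sp + F))) :
    Run W procs S pushCall σ (fun t σ' => t ≤ T + 2 ∧ SelectPost K L r (sp + F) σ σ') := by
  have h3 : σ.reg 3 = F := by simpa using hpre.reg3
  have hW := hpre.le_W
  have hle : F ≤ (L.length + 1) * F := Nat.le_mul_of_pos_left _ (by omega)
  simp only [pushCall, run_seq, run_op]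
  simp only [Operand.eval, WordOp.eval, h3, h4]
  refine ⟨by omega, (hcall _ hpre).mono ?_⟩
  rintro t σ' ⟨ht, h8, hb, hk⟩
  have f4 : σ'.reg 4 = sp + F := by rw [hk.2 4 (by omega)]; simp
  have f3 : σ'.reg 3 = F := by rw [hk.2 3 (by omega)]; simp [h3]
  simp only [f3, f4]
  refine ⟨by omega, by omega, ⟨by simpa using h8, by simpa using hb, fun x hx => ?_, fun j hj => ?_⟩⟩
  · simpa using hk.1 x hx
  · have := hk.2 j hj
    simp only [State.reg_setReg] at this ⊢
    split
    · rename_i hj4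
      rw [hj4, h4]
      omega
    · rename_i hj4
      rw [this, if_neg hj4]

theorem run_selectTop {L : List ℕ} {r sp F T : ℕ} {σ : State}
    (hcall : ∀ τ, SelectPre n W L sp r (sp + F) F τ →
      Run W procs S (.call 0) τ (fun t σ' => t ≤ T ∧ SelectPost K L r (sp + F) τ σ'))
    (h3 : σ.reg 3 = F) (h4 : σ.reg 4 = sp) (h7 : σ.reg 7 = r) (h10 : σ.reg 10 = L.length)
    (hr : r < L.length) (hL : Holds σ.mem sp L) (hLn : ∀ y ∈ L, y < n) (hnd : L.Nodup)
    (hF : n + 3 ≤ F) (hW : sp + (L.length + 2) * F ≤ W) (hW' : 16 ≤ W) :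
    Run W procs S selectTop σ (fun t σ' => t ≤ T + 4 ∧ SelectPost K L r (sp + F) σ σ') := by
  have hlen := length_le_of_nodup hnd hLn
  have hmul : (L.length + 2) * F = F + (L.length + 1) * F := by ring
  simp only [selectTop, run_seq, run_op]
  simp only [Operand.eval, WordOp.eval, h4, h10, State.reg_setReg]
  refine ⟨by omega, by simp; omega, (run_pushCall hcall (by simp [h4]) ?_).mono ?_⟩
  · constructor <;> first | omega | assumption | (simp; try omega)
  · rintro t σ' ⟨ht, h8, hb, hk⟩
    refine ⟨by omega, h8, hb, fun x hx => by simpa using hk.1 x hx, fun j hj => ?_⟩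
    rw [hk.2 j hj]
    simp [show j ≠ 5 by omega, show j ≠ 6 by omega]

/-- Comparing `r` with the rank of the pivot tells which side to search. The recursive call enters
as the hypothesis `hcall`, with a bound `B` on the size of both sides. The input array lies below
`sp`, so the first filter pass leaves it intact for the second, which may overwrite the output of
the first. -/
theorem run_selectByPivot (hK : IsRank S K) {L : List ℕ} {a r sp F B q : ℕ} {σ : State}
    (hcall : ∀ (L' : List ℕ) (r' : ℕ) τ, L'.length ≤ B → SelectPre n W L' sp r' (sp + F) F τ →
      Run W procs S (.call 0) τ
        (fun t σ' => t ≤ 2000 * L'.length ∧ SelectPost K L' r' (sp + F) τ σ'))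
    (hpre : SelectPre n W L a r sp F σ) (h8 : σ.reg 8 = q) (hq : q ∈ L)
    (hB : below K L q ≤ B) (hB' : above K L q ≤ B) :
    Run W procs S selectByPivot σ
      (fun t σ' => t ≤ 2000 * B + L.length * 18 + 20 ∧ SelectPost K L r sp σ σ') := by
  obtain ⟨h3, h4, h5, h6, h7, hr, hL, hLn, hnd, hle, hF, hW, hW'⟩ := hpre
  have hlen := length_le_of_nodup hnd hLn
  have hFW : F ≤ (L.length + 1) * F := Nat.le_mul_of_pos_left _ (by omega)
  have hqn := hLn q hq
  have hsum := below_add_above hnd (hK.bijOn.injOn.mono (fun x hx => hLn x hx)) hq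
  -- Each nested call works on a strictly shorter list, so a budget of one frame per element, plus
  -- one, suffices for the whole recursion.
  have hbound : ∀ m, m < L.length → sp + (m + 2) * F ≤ W := fun m hm =>
    le_trans (Nat.add_le_add_left (Nat.mul_le_mul_right F (by omega)) sp) hW
  simp only [selectByPivot]
  rw [run_seq]
  refine (run_filterPass hK true h4 h5 h6 h8 hL hLn hqn hle (by omega) (by omega)).mono ?_
  rintro t₁ σ₁ ⟨ht₁, h10, hH, hm₁, hreg₁⟩
  have e3 : σ₁.reg 3 = F := by rw [hreg₁ 3 (by omega), h3]
  have e4 : σ₁.reg 4 = sp := by rw [hreg₁ 4 (by omega), h4]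
  have e5 : σ₁.reg 5 = a := by rw [hreg₁ 5 (by omega), h5]
  have e6 : σ₁.reg 6 = L.length := by rw [hreg₁ 6 (by omega), h6]
  have e7 : σ₁.reg 7 = r := by rw [hreg₁ 7 (by omega), h7]
  have e8 : σ₁.reg 8 = q := by rw [hreg₁ 8 (by omega), h8]
  have hk₁ : Keeps sp σ σ₁ := ⟨hm₁, fun j hj => hreg₁ j (by omega)⟩
  have h10' := h10
  rw [length_filter_side_true] at h10'
  rw [run_seq, run_op, run_cond]
  simp only [Operand.eval, WordOp.eval, State.reg_setReg, e7, h10', if_true]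
  refine ⟨ite_one_zero_le (by omega), fun hlt => ?_, fun hge => ?_⟩
  · have hlt' : r < below K L q := by
      by_contra hc
      simp [hc] at hlt
    refine (run_selectTop (K := K) (r := r) (sp := sp) (F := F)
      (L := (L.filter (side K q true)).reverse)
      (fun τ hτ => hcall _ _ τ (by simpa [length_filter_side_true] using hB) hτ)
      (by simp [e3]) (by simp [e4]) (by simp [e7]) (by simp [h10])
      (by simpa [length_filter_side_true] using hlt') (by simpa using hH)
      (fun y hy => hLn y ?_) (by simpa using hnd.filter _) hF ?_ hW').mono ?_
    · simp only [List.mem_reverse, List.mem_filter] at hy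
      exact hy.1
    · rw [List.length_reverse, length_filter_side_true]
      exact hbound _ (below_lt_length hq)
    · rintro t σ' ⟨ht, hx, hb, hk⟩
      rw [List.length_reverse, length_filter_side_true] at ht
      rw [List.mem_reverse, List.mem_filter] at hx
      refine ⟨by omega, hx.1, ?_, hk₁.trans ⟨fun x hx => ?_, fun j hj => ?_⟩ le_rfl⟩
      · rw [← hb, below_reverse, below_filter_low]
        have := hx.2
        simp [side] at this
        omega
      · simpa using hk.1 x (by omega)
      · rw [hk.2 j hj]
        simp [show j ≠ 16 by omega]
  · have hge' : below K L q ≤ r := by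
      by_contra hc
      simp [not_le.1 hc] at hge
    rw [run_seq, run_op, run_cond]
    simp only [Operand.eval, WordOp.eval, State.reg_setReg, e7, h10', if_true]
    refine ⟨by simp; omega, fun hne => ?_, fun heq => ?_⟩
    · simp at hne
      rw [run_seq, run_op, run_seq]
      refine ⟨by simp; omega, ?_⟩
      simp only [Operand.eval, WordOp.eval, State.reg_setReg, e7, if_true]
      refine (run_filterPass hK (L := L) (a := a) (sp := sp) (q := q) false (by simp [e4])
        (by simp [e5]) (by simp [e6]) (by simp [e8])
        (by simpa using hL.congr fun x _ hx => hm₁ x (by omega)) hLn hqn hle (by omega)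
        (by omega)).mono ?_
      rintro t₂ σ₂ ⟨ht₂, g10, hH₂, hm₂, hreg₂⟩
      have hk₂ : Keeps sp σ₁ σ₂ := by
        refine ⟨fun x hx => by simpa using hm₂ x hx, fun j hj => ?_⟩
        rw [hreg₂ j (by omega)]
        simp [show j ≠ 7 by omega, show j ≠ 16 by omega]
      refine (run_selectTop (K := K) (r := r - below K L q - 1) (sp := sp) (F := F)
        (L := (L.filter (side K q false)).reverse)
        (fun τ hτ => hcall _ _ τ (by simpa [length_filter_side_false] using hB') hτ)
        (by rw [hreg₂ 3 (by omega)]; simp [e3]) (by rw [hreg₂ 4 (by omega)]; simp [e4])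
        (by rw [hreg₂ 7 (by omega)]; simp) (by simp [g10])
        (by simp [length_filter_side_false]; omega) hH₂
        (fun y hy => hLn y ?_) (by simpa using hnd.filter _) hF ?_ hW').mono ?_
      · simp only [List.mem_reverse, List.mem_filter] at hy
        exact hy.1
      · rw [List.length_reverse, length_filter_side_false]
        exact hbound _ (by omega)
      · rintro t σ' ⟨ht, hx, hb, hk⟩
        rw [List.length_reverse, length_filter_side_false] at ht
        rw [List.mem_reverse, List.mem_filter] at hx
        refine ⟨by omega, hx.1, ?_, (hk₁.trans hk₂ le_rfl).trans hk (by omega)⟩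
        rw [below_reverse] at hb
        have hx2 := hx.2
        simp [side] at hx2
        have := below_filter_high (K := K) L hx2
        omega
    -- The requested rank is exactly that of the pivot, which is still in register `8`.
    · simp at heq
      simp only [run_skip]
      refine ⟨by omega, by simpa [e8] using hq, by simp [e8]; omega,
        hk₁.trans ⟨fun x hx => by simp, fun j hj => ?_⟩ le_rfl⟩
      simp [show j ≠ 7 by omega, show j ≠ 16 by omega]

/-- The two recursive calls together concern at most `15/16` of `l` elements, thanks to `60 ≤ l`,
and so cost at most `1875 * l`. The remaining `125 * l` covers `219 / 5 + 18 < 62` steps per element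
and the additive constants. -/
theorem select_time {l t₁ t₂ t₃ : ℕ} (hl : 60 ≤ l) (h₁ : t₁ ≤ l / 5 * 219 + 1)
    (h₂ : t₂ ≤ 2000 * (l / 5) + 2)
    (h₃ : t₃ ≤ 2000 * (l - 1 - 3 * (l / 5 - 1 - l / 5 / 2)) + l * 18 + 20) :
    t₁ + t₂ + t₃ + 60 ≤ 2000 * l := by
  have h : 16 * (l / 5 + (l - 1 - 3 * (l / 5 - 1 - l / 5 / 2))) ≤ 15 * l := by omega
  have h' : 5 * (l / 5) ≤ l := by omega
  generalize l - 1 - 3 * (l / 5 - 1 - l / 5 / 2) = B at *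
  generalize l / 5 = m at *
  omega

/-- Induction on a bound for the length, since both recursive calls are on shorter lists: the group
medians, and one side of the pivot. -/
theorem run_select (hK : IsRank S K) (hp : procs[0]? = some select) (N : ℕ) :
    ∀ {L : List ℕ} {a r sp F : ℕ} {σ : State}, L.length ≤ N → SelectPre n W L a r sp F σ →
      Run W procs S (.call 0) σ
        (fun t σ' => t ≤ 2000 * L.length ∧ SelectPost K L r sp σ σ') := by
  induction N with
  | zero =>
    intro L a r sp F σ hN hpre
    have := hpre.lt
    omega
  | succ N ih =>
    intro L a r sp F σ hN hpre
    obtain ⟨h3, h4, h5, h6, h7, hr, hL, hLn, hnd, hle, hF, hW, hW'⟩ := hpre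
    have hlen := length_le_of_nodup hnd hLn
    have hFW : F ≤ (L.length + 1) * F := Nat.le_mul_of_pos_left _ (by omega)
    have hbound : ∀ m, m < L.length → sp + F + (m + 1) * F ≤ W := fun m hm => by
      have h1 : (m + 1 + 1) * F ≤ (L.length + 1) * F := Nat.mul_le_mul_right F (by omega)
      have h2 : (m + 1 + 1) * F = F + (m + 1) * F := by ring
      omega
    refine run_call hp ?_
    rw [select, run_seq, run_op, run_cond]
    simp only [Operand.eval, WordOp.eval, State.reg_setReg, h6, if_true]
    refine ⟨ite_one_zero_le (by omega), fun hlt => ?_, fun hge => ?_⟩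
    · have hlt' : L.length < 60 := by
        by_contra hc
        simp [hc] at hlt
      refine (run_bruteSelect hK (L := L) (b := a) (r := r) (by simp [h5]) (by simp [h6])
        (by simp [h7]) (by simpa using hL) hLn hnd hr (by omega) (by omega) hW').mono ?_
      rintro t σ' ⟨ht, h8, hb, hm, hreg⟩
      refine ⟨?_, h8, hb, fun x hx => by simp [hm], fun j hj => ?_⟩
      -- At most `59` elements, and `59 * 6 + 12 = 366`.
      · have : L.length * (L.length * 6 + 12) ≤ L.length * 366 :=
          Nat.mul_le_mul_left _ (by omega)
        omega
      · rw [hreg j (by omega)]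
        simp [show j ≠ 16 by omega]
    · have hge' : 60 ≤ L.length := by
        by_contra hc
        simp [not_le.1 hc] at hge
      simp [h4, h5, h6, h7]
      refine ⟨by omega, by omega, by omega, by omega, by omega, by omega, by omega, by omega,
        by omega, by omega, ?_⟩
      refine (run_medians hK (L := L) (a := a) (sp := sp) (m := L.length / 5) (by simp [h4])
        (by simp) (by simp) (by simp) (by simp) ?_ hLn hnd (by omega) hle (by omega) (by omega)
        hW').mono ?_
      · refine hL.congr fun x _ hx => ?_
        simp [show x ≠ sp + 2 by omega, show x ≠ sp + 1 by omega, show x ≠ sp by omega]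
      rintro t₁ σ₁ ⟨ht₁, ⟨M, hM, hMl, hR⟩, hm₁, hreg₁⟩
      have e3 : σ₁.reg 3 = F := by rw [hreg₁ 3 (by omega)]; simp [h3]
      have e4 : σ₁.reg 4 = sp := by rw [hreg₁ 4 (by omega)]; simp [h4]
      have e16 : σ₁.reg 16 = L.length / 5 := by rw [hreg₁ 16 (by omega)]; simp
      have m0 : σ₁.mem sp = a := by rw [hm₁ _ (by omega)]; simp
      have m1 : σ₁.mem (sp + 1) = L.length := by rw [hm₁ _ (by omega)]; simp
      have m2 : σ₁.mem (sp + 2) = r := by rw [hm₁ _ (by omega)]; simp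
      have hk₁ : Keeps sp σ σ₁ := by
        refine ⟨fun x hx => ?_, fun j hj => ?_⟩
        · rw [hm₁ x (by omega)]
          simp [show x ≠ sp + 2 by omega, show x ≠ sp + 1 by omega, show x ≠ sp by omega]
        · rw [hreg₁ j (by omega)]
          simp [show j ≠ 6 by omega, show j ≠ 7 by omega, show j ≠ 14 by omega,
            show j ≠ 16 by omega, show j ≠ 15 by omega, show j ≠ 13 by omega]
      clear hm₁ hreg₁
      have hMnd := hnd.sublist hR.sublist
      have hMn : ∀ y ∈ M, y < n := fun y hy => hLn y (hR.sublist.subset hy)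
      simp only [e4, e16]
      refine ⟨by omega, by omega, by omega, ?_⟩
      refine (run_pushCall (K := K) (L := M) (a := sp + 3) (r := L.length / 5 / 2) (sp := sp)
        (F := F) (T := 2000 * M.length) (fun τ hτ => ih (by omega) hτ) (by simp [e4]) ?_).mono ?_
      · have := hbound M.length (by omega)
        constructor <;> first | omega | assumption | (simp; try omega)
      rintro t₂ σ₂ ⟨ht₂, h8, hb, hk₂⟩
      have hk₂' : Keeps (sp + F) σ₁ σ₂ := by
        refine ⟨fun x hx => by simpa using hk₂.1 x hx, fun j hj => ?_⟩
        rw [hk₂.2 j hj]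
        simp [show j ≠ 7 by omega, show j ≠ 6 by omega, show j ≠ 5 by omega]
      have f3 : σ₂.reg 3 = F := by rw [hk₂'.2 3 (by omega), e3]
      have f4 : σ₂.reg 4 = sp := by rw [hk₂'.2 4 (by omega), e4]
      have g0 : σ₂.mem sp = a := by rw [hk₂'.1 _ (by omega), m0]
      have g1 : σ₂.mem (sp + 1) = L.length := by rw [hk₂'.1 _ (by omega), m1]
      have g2 : σ₂.mem (sp + 2) = r := by rw [hk₂'.1 _ (by omega), m2]
      have hk : Keeps sp σ σ₂ := hk₁.trans hk₂' (by omega)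
      clear hk₁ hk₂ hk₂' m0 m1 m2 e3 e4 e16
      simp only [f4, g0, g1, g2]
      refine ⟨by omega, by omega, ?_⟩
      have hMsum := below_add_above hMnd (hK.bijOn.injOn.mono (fun x hx => hMn x hx)) h8
      have h8L := hR.sublist.subset h8
      have hLsum := below_add_above hnd (hK.bijOn.injOn.mono (fun x hx => hLn x hx)) h8L
      have hlow := hR.below_le (σ₂.reg 8)
      have hhigh := hR.above_le (σ₂.reg 8)
      -- With `m = L.length / 5`, the pivot has `m / 2` group medians below it and `m - 1 - m / 2`
      -- above it; each side of `L` contains at least three times as many elements, and the smaller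
      -- of the two numbers serves both bounds.
      have hB : below K L (σ₂.reg 8) ≤ L.length - 1 - 3 * (L.length / 5 - 1 - L.length / 5 / 2) := by
        omega
      have hB' : above K L (σ₂.reg 8) ≤
          L.length - 1 - 3 * (L.length / 5 - 1 - L.length / 5 / 2) := by
        omega
      refine (run_selectByPivot hK (L := L) (a := a) (r := r) (sp := sp) (F := F)
        (q := σ₂.reg 8) (fun L' r' τ hL' hτ => ih (by omega) hτ) ?_ (by simp) h8L hB hB').mono ?_
      · constructor <;> first | omega | assumption | (simp; try omega)
        refine hL.congr fun x _ hx => ?_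
        simpa using hk.1 x (by omega)
      · rintro t₃ σ₃ ⟨ht₃, hx, hb₃, hk₃⟩
        have htime := select_time hge' ht₁ (hMl ▸ ht₂) ht₃
        refine ⟨by linarith only [htime], hx, hb₃, hk.trans ⟨fun x hx => ?_, fun j hj => ?_⟩ le_rfl⟩
        · simpa using hk₃.1 x hx
        · rw [hk₃.2 j hj]
          simp [show j ≠ 7 by omega, show j ≠ 6 by omega, show j ≠ 5 by omega,
            show j ≠ 13 by omega]

end

end RangeMedian

/-! ### Splitting one node of the rank tree. -/

namespace RangeMedian

/-- The number of positions below `x` with rank in `[a, b)`. -/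
def cnt (K : ℕ → ℕ) (a b x : ℕ) : ℕ := Nat.count (fun y => a ≤ K y ∧ K y < b) x

/-- The positions with rank in `[a, b)` are stored at depth `d`, in increasing order. -/
def Present (K : ℕ → ℕ) (n : ℕ) (μ : ℕ → ℕ) (d a b : ℕ) : Prop :=
  ∀ x < n, a ≤ K x → K x < b → μ (4 * n * d + (a + cnt K a b x)) = x

/-- The numbers of positions that go from the node `[a, b)` to its left child `[a, m)` are stored
at depth `d`, increased by one. -/
def Counted (K : ℕ → ℕ) (n : ℕ) (μ : ℕ → ℕ) (d a b m : ℕ) : Prop :=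
  ∀ x ≤ n, μ (4 * n * d + n + 2 * a + cnt K a b x) = cnt K a m x + 1

/-- Distribute the positions of a node to its children: register `33` is the address of the first
position, register `35` the number of positions, register `8` the pivot, register `25` the address
of the level, registers `23` and `28` are the first ranks of the children, and register `27` is
the address of the counts. -/
def distribute : Stmt :=
  .loop (.reg 35) (
    .op 35 .sub (.reg 35) (.lit 1) ;; .op 37 .add (.reg 33) (.reg 34) ;; .load 37 (.reg 37) ;;
    .less 38 (.reg 37) (.reg 8) ;; .op 39 .add (.reg 25) (.reg 3) ;;
    .cond (.reg 38)
      (.op 39 .add (.reg 39) (.reg 23) ;; .op 39 .add (.reg 39) (.reg 36) ;;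
        .store (.reg 39) (.reg 37) ;; .op 36 .add (.reg 36) (.lit 1))
      (.op 39 .add (.reg 39) (.reg 28) ;; .op 40 .sub (.reg 34) (.reg 36) ;;
        .op 39 .add (.reg 39) (.reg 40) ;; .store (.reg 39) (.reg 37)) ;;
    .op 34 .add (.reg 34) (.lit 1) ;; .op 39 .add (.reg 27) (.reg 34) ;;
    .op 40 .add (.reg 36) (.lit 1) ;; .store (.reg 39) (.reg 40))

/-- Split the node of ranks between registers `23` and `24` at the rank in register `28`. -/
def split : Stmt :=
  .op 5 .add (.reg 25) (.reg 23) ;; .op 6 .sub (.reg 24) (.reg 23) ;;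
  .op 7 .sub (.reg 28) (.reg 23) ;; .call 0 ;;
  .op 33 .add (.reg 25) (.reg 23) ;; .op 34 .add (.lit 0) (.lit 0) ;;
  .op 35 .sub (.reg 24) (.reg 23) ;; .op 36 .add (.lit 0) (.lit 0) ;;
  .store (.reg 27) (.lit 1) ;; distribute

/-- The constants that are kept in registers, and enough room in a word. -/
structure Env (n W : ℕ) (σ : State) : Prop where
  reg2 : σ.reg 2 = n
  reg3 : σ.reg 3 = 4 * n
  reg4 : σ.reg 4 = 4 * n * (n + 2)
  le_W : 4 * n * (n + 2) + (n + 1) * (4 * n) ≤ W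
  W_ge : 16 ≤ W

/-- The registers describe the node `[a, b)` at depth `d`, its midpoint `m`, and the address of its
counts. -/
structure AtNode (n d a b m : ℕ) (σ : State) : Prop where
  reg23 : σ.reg 23 = a
  reg24 : σ.reg 24 = b
  reg25 : σ.reg 25 = 4 * n * d
  reg27 : σ.reg 27 = 4 * n * d + n + 2 * a
  reg28 : σ.reg 28 = m

/-- Outside the stack, only the cells that belong to the node `[a, b)` at depth `d` differ. -/
def SplitFrame (n d a b : ℕ) (μ μ' : ℕ → ℕ) : Prop :=
  ∀ x < 4 * n * (n + 2), ¬ (4 * n * (d + 1) + a ≤ x ∧ x < 4 * n * (d + 1) + b) →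
    ¬ (4 * n * d + n + 2 * a ≤ x ∧ x ≤ 4 * n * d + n + 2 * a + (b - a)) → μ' x = μ x

/-- The situation after `i` positions of the node `[a, b)` at depth `d` have been distributed, `lo`
of them to the left child; `μ₀` is the memory at the beginning. -/
structure Distributed (K : ℕ → ℕ) (n d a b m i lo : ℕ) (μ₀ μ : ℕ → ℕ) : Prop where
  low : ∀ x ≤ n, cnt K a b x = i → cnt K a m x = lo
  left : ∀ x < n, a ≤ K x → K x < m → cnt K a b x < i →
    μ (4 * n * (d + 1) + (a + cnt K a m x)) = x
  right : ∀ x < n, m ≤ K x → K x < b → cnt K a b x < i →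
    μ (4 * n * (d + 1) + (m + cnt K m b x)) = x
  counts : ∀ x ≤ n, cnt K a b x ≤ i → μ (4 * n * d + n + 2 * a + cnt K a b x) = cnt K a m x + 1
  frame : SplitFrame n d a b μ₀ μ

section
variable {α : Type*} [LinearOrder α] {n : ℕ} {W : ℕ} {procs : List Stmt} {S : Fin n → α}
  {K : ℕ → ℕ}

theorem cnt_zero (a b : ℕ) : cnt K a b 0 = 0 := Nat.count_zero _

theorem cnt_succ (a b x : ℕ) :
    cnt K a b (x + 1) = cnt K a b x + if a ≤ K x ∧ K x < b then 1 else 0 := Nat.count_succ _ _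

theorem cnt_mono (a b : ℕ) {x y : ℕ} (h : x ≤ y) : cnt K a b x ≤ cnt K a b y :=
  Nat.count_monotone _ h

theorem cnt_add {a m b : ℕ} (h : a ≤ m) (h' : m ≤ b) (x : ℕ) :
    cnt K a m x + cnt K m b x = cnt K a b x := by
  induction x with
  | zero => simp [cnt_zero]
  | succ x ih =>
    simp only [cnt_succ]
    split_ifs <;> omega

theorem cnt_lt_cnt {a b x y : ℕ} (hx : a ≤ K x) (hx' : K x < b) (h : x < y) :
    cnt K a b x < cnt K a b y := by
  have := cnt_mono (K := K) a b (show x + 1 ≤ y from h)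
  rw [cnt_succ, if_pos ⟨hx, hx'⟩] at this
  exact this

/-- A discrete intermediate value argument: the count starts at `0` and jumps by one exactly at the
positions of the node. Thus `cnt` is the index of a position in the list of its node. -/
theorem exists_cnt_eq {a b i N : ℕ} (h : i < cnt K a b N) :
    ∃ x < N, a ≤ K x ∧ K x < b ∧ cnt K a b x = i := by
  induction N with
  | zero => simp [cnt_zero] at h
  | succ N ih =>
    by_cases hi : i < cnt K a b N
    · obtain ⟨x, hx, h'⟩ := ih hi
      exact ⟨x, by omega, h'⟩
    · rw [cnt_succ] at h
      split_ifs at h with hN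
      · exact ⟨N, by omega, hN.1, hN.2, by omega⟩
      · omega

theorem cnt_n (hK : IsRank S K) {a b : ℕ} (hb : b ≤ n) : cnt K a b n = b - a := by
  rw [cnt, Nat.count_eq_card_filter_range, ← Nat.card_Ico]
  refine Finset.card_nbij K ?_ ?_ ?_
  · intro x hx
    simpa using (Finset.mem_filter.1 hx).2
  · intro x hx y hy hxy
    simp only [Finset.coe_filter, Set.mem_ofPred_eq, Finset.mem_range] at hx hy
    exact hK.bijOn.injOn hx.1 hy.1 hxy
  · intro v hv
    simp only [Finset.coe_Ico, Set.mem_Ico] at hv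
    obtain ⟨x, hx, rfl⟩ := hK.bijOn.surjOn (show v ∈ Set.Iio n from lt_of_lt_of_le hv.2 hb)
    exact ⟨x, by simpa using ⟨hx, hv⟩, rfl⟩

/-- The positions with rank in `[a, b)`, in increasing order. -/
def nodeList (K : ℕ → ℕ) (n a b : ℕ) : List ℕ :=
  (List.range n).filter (fun y => a ≤ K y ∧ K y < b)

theorem mem_nodeList {a b x : ℕ} : x ∈ nodeList K n a b ↔ x < n ∧ a ≤ K x ∧ K x < b := by
  simp [nodeList]

theorem length_nodeList (hK : IsRank S K) {a b : ℕ} (hb : b ≤ n) :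
    (nodeList K n a b).length = b - a := by
  rw [← cnt_n hK hb, cnt, Nat.count, List.countP_eq_length_filter]
  rfl

/-- Links local to global ranks: selecting local rank `m - a` in the node `[a, b)` yields the pivot
of global rank `m`. -/
theorem below_nodeList (hK : IsRank S K) {a b x : ℕ} (hx : x < n) (hxb : K x < b) :
    below K (nodeList K n a b) x = K x - a := by
  rw [← cnt_n hK (show K x ≤ n from (hK.bijOn.mapsTo hx).le), cnt, Nat.count, below, nodeList,
    List.countP_filter]
  refine List.countP_congr fun y _ => ?_
  simp
  omega

theorem Present.holds {μ : ℕ → ℕ} {d a b : ℕ} (h : Present K n μ d a b) :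
    Holds μ (4 * n * d + a) (nodeList K n a b) := by
  have : ∀ N ≤ n, Holds μ (4 * n * d + a) (nodeList K N a b) := by
    intro N hN
    induction N with
    | zero => intro i hi; simp [nodeList] at hi
    | succ N ih =>
      have hlen : (nodeList K N a b).length = cnt K a b N := by
        rw [cnt, Nat.count, List.countP_eq_length_filter]
        rfl
      have ih' := ih (by omega)
      rw [nodeList] at ih' hlen ⊢
      rw [List.range_succ, List.filter_append]
      by_cases hp : a ≤ K N ∧ K N < b
      · have := h N (by omega) hp.1 hp.2
        rw [List.filter_cons_of_pos (by simpa using hp)]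
        refine ih'.concat ?_
        rw [hlen, add_assoc, this]
      · rw [List.filter_cons_of_neg (by simpa using hp)]
        simpa using ih'
  exact this n le_rfl

/-- The position `x₀` is the only one with index `i` in the node, and those of smaller index precede
it. It goes to the first free cell of its child, `lo` or `i - lo` cells after the start, which
differs from all cells filled so far. Only the count for prefixes of length `i + 1` is new. -/
theorem Distributed.step (hK : IsRank S K) {d a b m i lo tgt x₀ : ℕ} {μ₀ μ μ' : ℕ → ℕ}
    (h : Distributed K n d a b m i lo μ₀ μ) (ham : a ≤ m) (hmb : m ≤ b) (hbn : b ≤ n)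
    (hi : i < b - a) (hx₀ : x₀ < n) (hax₀ : a ≤ K x₀) (hxb₀ : K x₀ < b) (hcx₀ : cnt K a b x₀ = i)
    (htgt : tgt = 4 * n * d + 4 * n + (if K x₀ < m then a + lo else m + (i - lo)))
    (hm' : ∀ y, μ' y = if y = 4 * n * d + n + 2 * a + (i + 1)
      then lo + (if K x₀ < m then 1 else 0) + 1 else if y = tgt then x₀ else μ y) :
    Distributed K n d a b m (i + 1) (lo + if K x₀ < m then 1 else 0) μ₀ μ' := by
  obtain ⟨hlo, hL, hR, hC, hF⟩ := h
  have hP1 : 4 * n * (d + 1) = 4 * n * d + 4 * n := by ring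
  have hlo₀ := hlo x₀ hx₀.le hcx₀
  have hadd := fun x => cnt_add (K := K) ham hmb x
  have hbefore : ∀ x, a ≤ K x → K x < b → cnt K a b x < i → x < x₀ := by
    intro x _ _ hx
    by_contra hc
    have := cnt_mono (K := K) a b (not_lt.1 hc)
    omega
  have hafter : ∀ x, cnt K a b x = i + 1 → x₀ + 1 ≤ x := by
    intro x hx
    by_contra hc
    have := cnt_mono (K := K) a b (show x ≤ x₀ by omega)
    omega
  have heq : ∀ x, a ≤ K x → K x < b → cnt K a b x = i → x = x₀ := by
    intro x h1 h2 hx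
    rcases lt_trichotomy x x₀ with h | h | h
    · have := cnt_lt_cnt h1 h2 h
      omega
    · exact h
    · have := cnt_lt_cnt hax₀ hxb₀ h
      omega
  have hs := cnt_succ (K := K) a b x₀
  rw [if_pos ⟨hax₀, hxb₀⟩] at hs
  have hn1 := cnt_n hK (a := a) (b := m) (by omega)
  have hn2 := cnt_n hK (a := m) (b := b) hbn
  have hle1 := cnt_mono (K := K) a m (show x₀ + 1 ≤ n from hx₀)
  have hle2 := cnt_mono (K := K) m b (show x₀ + 1 ≤ n from hx₀)
  have hadd₀ := hadd x₀
  have hadd₁ := hadd (x₀ + 1)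
  -- The two child counts are monotone and their sum does not change between `x₀ + 1` and `x`, so
  -- neither of them changes.
  have hlo' : ∀ x, cnt K a b x = i + 1 → cnt K a m x = cnt K a m (x₀ + 1) := by
    intro x hx
    have h1 := cnt_mono (K := K) a m (hafter x hx)
    have h2 := cnt_mono (K := K) m b (hafter x hx)
    have := hadd x
    omega
  have hlow : ∀ x, K x₀ < m → a ≤ K x → x < x₀ → K x < m → cnt K a m x < lo := by
    intro x h1 h2 h3 h4
    have := cnt_lt_cnt h2 h4 h3
    omega
  have hhigh : ∀ x, m ≤ K x → x < x₀ → K x < b → cnt K m b x < i - lo := by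
    intro x h2 h3 h4
    have := cnt_lt_cnt h2 h4 h3
    omega
  have hs1 : cnt K a m (x₀ + 1) = lo + if K x₀ < m then 1 else 0 := by
    rw [cnt_succ, hlo₀]
    simp [hax₀]
  have hside1 : K x₀ < m → (if K x₀ < m then 1 else 0) = 1 := fun h => if_pos h
  generalize (if K x₀ < m then 1 else 0) = e at *
  have htgt' : 4 * n * d + 4 * n + a ≤ tgt ∧ tgt < 4 * n * d + 4 * n + b := by
    by_cases hside : K x₀ < m
    · have := hside1 hside
      rw [if_pos hside] at htgt
      omega
    · have := cnt_succ (K := K) m b x₀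
      rw [if_pos ⟨by omega, hxb₀⟩] at this
      rw [if_neg hside] at htgt
      omega
  refine ⟨fun x _ hx => by rw [hlo' x hx, hs1], ?_, ?_, ?_, ?_⟩
  · intro x hx h1 h2 hc
    have hb1 := cnt_mono (K := K) a m hx.le
    rw [hm', if_neg (by omega)]
    by_cases hci : cnt K a b x = i
    · obtain rfl := heq x h1 (by omega) hci
      rw [if_pos h2] at htgt
      rw [if_pos (by omega)]
    · have hxx := hbefore x h1 (by omega) (by omega)
      rw [if_neg, hL x hx h1 h2 (by omega)]
      by_cases hside : K x₀ < m
      · have := hlow x hside h1 hxx h2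
        rw [if_pos hside] at htgt
        omega
      · rw [if_neg hside] at htgt
        have := cnt_lt_cnt h1 h2 hx
        omega
  · intro x hx h1 h2 hc
    have hb1 := cnt_mono (K := K) m b hx.le
    rw [hm', if_neg (by omega)]
    by_cases hci : cnt K a b x = i
    · obtain rfl := heq x (by omega) h2 hci
      rw [if_neg (by omega)] at htgt
      rw [if_pos (by omega)]
    · have hxx := hbefore x (by omega) h2 (by omega)
      rw [if_neg, hR x hx h1 h2 (by omega)]
      by_cases hside : K x₀ < m
      · have := hside1 hside
        rw [if_pos hside] at htgt
        omega
      · have := hhigh x h1 hxx h2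
        rw [if_neg hside] at htgt
        omega
  · intro x hx hc
    rw [hm']
    by_cases hci : cnt K a b x = i + 1
    · rw [if_pos (by omega), hlo' x hci, hs1]
    · rw [if_neg (by omega), if_neg (by omega), hC x hx (by omega)]
  · intro y hy h1 h2
    rw [hm', if_neg (by omega), if_neg (by omega), hF y hy h1 h2]

theorem run_distribute (hK : IsRank S K) {σ : State} {d a b m q : ℕ} (hE : Env n W σ)
    (hN : AtNode n d a b m σ) (ham : a ≤ m) (hmb : m ≤ b) (hbn : b ≤ n) (hd : d + 1 ≤ n)
    (h8 : σ.reg 8 = q) (hq : q < n) (hqm : K q = m) (h33 : σ.reg 33 = 4 * n * d + a)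
    (h34 : σ.reg 34 = 0) (h35 : σ.reg 35 = b - a) (h36 : σ.reg 36 = 0)
    (h0 : σ.mem (4 * n * d + n + 2 * a) = 1) (hP : Present K n σ.mem d a b) :
    Run W procs S distribute σ (fun t σ' => t ≤ (b - a) * 17 + 1 ∧
      Present K n σ'.mem (d + 1) a m ∧ Present K n σ'.mem (d + 1) m b ∧
      Counted K n σ'.mem d a b m ∧ SplitFrame n d a b σ.mem σ'.mem ∧
      ∀ j, j < 34 ∨ 41 ≤ j → σ'.reg j = σ.reg j) := by
  obtain ⟨h2, h3, h4, hW, hW'⟩ := hE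
  obtain ⟨h23, h24, h25, h27, h28⟩ := hN
  have hZ : 4 * n * (d + 2) ≤ 4 * n * (n + 2) := Nat.mul_le_mul_left _ (by omega)
  have hP1 : 4 * n * (d + 1) = 4 * n * d + 4 * n := by ring
  have hP2 : 4 * n * (d + 2) = 4 * n * d + 8 * n := by ring
  rw [hP2] at hZ
  have hn := cnt_n hK (a := a) hbn
  let Inv : ℕ → State → Prop := fun rem σ' => ∃ i lo, rem + i = b - a ∧ σ'.reg 34 = i ∧
    σ'.reg 36 = lo ∧ Distributed K n d a b m i lo σ.mem σ'.mem ∧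
    ∀ j, j < 34 ∨ 41 ≤ j → σ'.reg j = σ.reg j
  refine (run_countdown Inv 16 ?_ h35 ?_).mono ?_
  · rintro rem τ hrem ⟨i, lo, hi, h34, h36, hD, hreg⟩
    have e3 : τ.reg 3 = 4 * n := by rw [hreg 3 (by omega), h3]
    have e8 : τ.reg 8 = q := by rw [hreg 8 (by omega), h8]
    have e23 : τ.reg 23 = a := by rw [hreg 23 (by omega), h23]
    have e25 : τ.reg 25 = 4 * n * d := by rw [hreg 25 (by omega), h25]
    have e27 : τ.reg 27 = 4 * n * d + n + 2 * a := by rw [hreg 27 (by omega), h27]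
    have e28 : τ.reg 28 = m := by rw [hreg 28 (by omega), h28]
    have e33 : τ.reg 33 = 4 * n * d + a := by rw [hreg 33 (by omega), h33]
    obtain ⟨x₀, hx₀, hax₀, hxb₀, hcx₀⟩ := exists_cnt_eq (K := K) (a := a) (b := b) (i := i) (N := n)
      (by omega)
    -- So far only cells of the next level and count cells have been written, so the list of the
    -- node is still intact.
    have hmem : τ.mem (4 * n * d + a + i) = x₀ := by
      rw [hD.frame _ (by omega) (by omega) (by omega), add_assoc, ← hcx₀]
      exact hP x₀ hx₀ hax₀ hxb₀
    have hloi : lo ≤ i ∧ lo ≤ m - a ∧ i - lo ≤ b - m := by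
      rw [← hD.low x₀ hx₀.le hcx₀, ← hcx₀, ← cnt_add ham hmb x₀, ← cnt_n hK (hmb.trans hbn),
        ← cnt_n hK hbn]
      have := cnt_mono (K := K) a m hx₀.le
      have := cnt_mono (K := K) m b hx₀.le
      omega
    have hstep := fun tgt μ' => hD.step (tgt := tgt) (μ' := μ') hK ham hmb hbn (by omega) hx₀ hax₀
      hxb₀ hcx₀
    have hPW : 4 * n * d + 8 * n ≤ W := by omega
    clear hZ hP1 hP2 hW hP hD hn h0 h2 h3 h4 h23 h24 h25 h27 h28 h33
    refine run_op_seq rem (by simp [hrem]) (by omega) ?_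
    refine run_op_seq (4 * n * d + a + i) (by simp [e33, h34]) (by omega) ?_
    refine run_load_seq x₀ (by simp [hmem]) ?_
    refine run_less_seq hK x₀ q (by simp) (by simp [e8]) hx₀ hq ?_
    refine run_op_seq (4 * n * d + 4 * n) (by simp [e25, e3]) (by omega) ?_
    by_cases hside : K x₀ < m
    · refine run_cond_seq_true (by simp [hside, hqm]) ?_
      refine run_seq_assoc (run_op_seq (4 * n * d + 4 * n + a) (by simp [e23]) (by omega) ?_)
      refine run_seq_assoc (run_op_seq (4 * n * d + 4 * n + a + lo) (by simp [h36]) (by omega) ?_)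
      refine run_seq_assoc (run_store_seq (4 * n * d + 4 * n + a + lo) x₀ (by simp) (by simp)
        (by omega) (by omega) ?_)
      refine run_op_seq (lo + 1) (by simp [h36]) (by omega) ?_
      refine run_op_seq (i + 1) (by simp [h34]) (by omega) ?_
      refine run_op_seq (4 * n * d + n + 2 * a + (i + 1)) (by simp [e27]) (by omega) ?_
      refine run_op_seq (lo + 1 + 1) (by simp) (by omega) ?_
      refine run_store.2 ⟨by simp; omega, by simp; omega, by omega, by simp, i + 1, lo + 1, by omega, by simp,
        by simp, ?_, ?_⟩
      · simp only [hside, if_true] at hstep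
        refine hstep (4 * n * d + 4 * n + a + lo) _ (add_assoc _ _ _) fun y => ?_
        simp
      · intro j hj
        rw [← hreg j hj]
        simp [show j ≠ 40 by omega, show j ≠ 39 by omega, show j ≠ 34 by omega,
          show j ≠ 36 by omega, show j ≠ 38 by omega, show j ≠ 37 by omega, show j ≠ 35 by omega]
    · refine run_cond_seq_false (by simp [hside, hqm]) ?_
      refine run_seq_assoc (run_op_seq (4 * n * d + 4 * n + m) (by simp [e28]) (by omega) ?_)
      refine run_seq_assoc (run_op_seq (i - lo) (by simp [h34, h36]) (by omega) ?_)
      refine run_seq_assoc (run_op_seq (4 * n * d + 4 * n + m + (i - lo)) (by simp) (by omega) ?_)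
      refine run_store_seq (4 * n * d + 4 * n + m + (i - lo)) x₀ (by simp) (by simp)
        (by omega) (by omega) ?_
      refine run_op_seq (i + 1) (by simp [h34]) (by omega) ?_
      refine run_op_seq (4 * n * d + n + 2 * a + (i + 1)) (by simp [e27]) (by omega) ?_
      refine run_op_seq (lo + 1) (by simp [h36]) (by omega) ?_
      refine run_store.2 ⟨by simp; omega, by simp; omega, by omega, by simp, i + 1, lo, by omega, by simp,
        by simp [h36], ?_, ?_⟩
      · simp only [hside, if_false, add_zero] at hstep
        refine hstep (4 * n * d + 4 * n + m + (i - lo)) _ (add_assoc _ _ _) fun y => ?_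
        simp
      · intro j hj
        rw [← hreg j hj]
        simp [show j ≠ 40 by omega, show j ≠ 39 by omega, show j ≠ 34 by omega,
          show j ≠ 38 by omega, show j ≠ 37 by omega, show j ≠ 35 by omega]
  · refine ⟨0, 0, by omega, h34, h36, ⟨fun x _ hx => ?_, fun x _ _ _ hx => by omega,
      fun x _ _ _ hx => by omega, fun x _ hx => ?_, fun _ _ _ _ => rfl⟩, fun _ _ => rfl⟩
    · have := cnt_add (K := K) ham hmb x
      omega
    · have := cnt_add (K := K) ham hmb x
      have h1 : cnt K a b x = 0 := by omega
      have h2 : cnt K a m x = 0 := by omega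
      rw [h1, h2]
      simpa using h0
  · rintro t σ' ⟨ht, _, i, lo, hi, _, _, ⟨_, hL, hR, hC, hF⟩, hreg⟩
    have hall : ∀ x ≤ n, cnt K a b x ≤ i := fun x hx => by
      have := cnt_mono (K := K) a b hx
      rw [cnt_n hK hbn] at this
      omega
    have hlt : ∀ x < n, a ≤ K x → K x < b → cnt K a b x < i := fun x hx h1 h2 => by
      have := cnt_lt_cnt h1 h2 hx
      have := hall n le_rfl
      omega
    exact ⟨ht, fun x hx h1 h2 => hL x hx h1 h2 (hlt x hx h1 (by omega)),
      fun x hx h1 h2 => hR x hx h1 h2 (hlt x hx (by omega) h2),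
      fun x hx => hC x hx (hall x hx), hF, hreg⟩

theorem run_split (hK : IsRank S K) (hp : procs[0]? = some select) {σ : State} {d a b m : ℕ}
    (hE : Env n W σ) (hN : AtNode n d a b m σ) (ham : a ≤ m) (hmb : m < b) (hbn : b ≤ n)
    (hd : d + 1 ≤ n) (hP : Present K n σ.mem d a b) :
    Run W procs S split σ (fun t σ' => t ≤ (b - a) * 2017 + 10 ∧
      Present K n σ'.mem (d + 1) a m ∧ Present K n σ'.mem (d + 1) m b ∧
      Counted K n σ'.mem d a b m ∧ SplitFrame n d a b σ.mem σ'.mem ∧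
      ∀ j, j < 5 ∨ 20 ≤ j ∧ j < 33 ∨ 41 ≤ j → σ'.reg j = σ.reg j) := by
  obtain ⟨h2, h3, h4, hW, hW'⟩ := hE
  obtain ⟨h23, h24, h25, h27, h28⟩ := hN
  have hlen := length_nodeList hK (a := a) hbn
  have hZ : 4 * n * d + 8 * n ≤ 4 * n * (n + 2) := by
    have : 4 * n * (d + 2) ≤ 4 * n * (n + 2) := Nat.mul_le_mul_left _ (by omega)
    have hP2 : 4 * n * (d + 2) = 4 * n * d + 8 * n := by ring
    omega
  have hmul : (b - a + 1) * (4 * n) ≤ (n + 1) * (4 * n) := Nat.mul_le_mul_right _ (by omega)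
  rw [split]
  refine run_op_seq (4 * n * d + a) (by simp [h25, h23]) (by omega) ?_
  refine run_op_seq (b - a) (by simp [h24, h23]) (by omega) ?_
  refine run_op_seq (m - a) (by simp [h28, h23]) (by omega) ?_
  rw [run_seq]
  -- The stack starts above all `n + 2` levels, so selection leaves the tree untouched. Frames of
  -- size `4 * n` satisfy `n + 3 ≤ 4 * n` because `1 ≤ n`.
  refine (run_select hK hp (nodeList K n a b).length (L := nodeList K n a b) (a := 4 * n * d + a)
    (r := m - a) (sp := 4 * n * (n + 2)) (F := 4 * n) le_rfl ?_).mono ?_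
  · constructor
    · simp [h3]
    · simp [h4]
    · simp
    · simp [hlen]
    · simp
    · omega
    · exact hP.holds
    · exact fun y hy => (mem_nodeList.1 hy).1
    · exact List.nodup_range.filter _
    · omega
    · omega
    · rw [hlen]
      omega
    · exact hW'
  rintro t σ₁ ⟨ht, h8, hb, hm, hreg⟩
  have hreg₁ : ∀ j, j < 5 ∨ 20 ≤ j → σ₁.reg j = σ.reg j := fun j hj => by
    rw [hreg j hj]
    simp [show j ≠ 5 by omega, show j ≠ 6 by omega, show j ≠ 7 by omega]
  have hm₁ : ∀ x < 4 * n * (n + 2), σ₁.mem x = σ.mem x := fun x hx => by simpa using hm x hx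
  clear hm hreg
  obtain ⟨h8n, h8a, h8b⟩ := mem_nodeList.1 h8
  rw [below_nodeList hK h8n h8b] at hb
  have e23 : σ₁.reg 23 = a := by rw [hreg₁ 23 (by omega), h23]
  have e24 : σ₁.reg 24 = b := by rw [hreg₁ 24 (by omega), h24]
  have e25 : σ₁.reg 25 = 4 * n * d := by rw [hreg₁ 25 (by omega), h25]
  have e27 : σ₁.reg 27 = 4 * n * d + n + 2 * a := by rw [hreg₁ 27 (by omega), h27]
  have e28 : σ₁.reg 28 = m := by rw [hreg₁ 28 (by omega), h28]
  refine run_op_seq (4 * n * d + a) (by simp [e25, e23]) (by omega) ?_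
  refine run_op_seq 0 (by simp) (by omega) ?_
  refine run_op_seq (b - a) (by simp [e24, e23]) (by omega) ?_
  refine run_op_seq 0 (by simp) (by omega) ?_
  -- The count of the empty prefix, `0`, increased by one. This cell also serves as the mark that
  -- the node has been split.
  refine run_store_seq (4 * n * d + n + 2 * a) 1 (by simp [e27]) (by simp) (by omega) (by omega) ?_
  refine (run_distribute hK (d := d) (a := a) (b := b) (m := m) (q := σ₁.reg 8) ?_ ?_ ham hmb.le
    hbn hd (by simp) h8n (by omega) (by simp) (by simp) (by simp) (by simp) (by simp) ?_).mono ?_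
  · constructor
    · simp [hreg₁, h2]
    · simp [hreg₁, h3]
    · simp [hreg₁, h4]
    · exact hW
    · exact hW'
  · constructor <;> simp [e23, e24, e25, e27, e28]
  · intro x hx hxa hxb
    have h1 := cnt_mono (K := K) a b hx.le
    rw [cnt_n hK hbn] at h1
    have h2 := cnt_lt_cnt hxa hxb hx
    rw [cnt_n hK hbn] at h2
    have := hP x hx hxa hxb
    simp only [State.mem_setMem, State.mem_setReg]
    rw [if_neg (by omega), hm₁ _ (by omega), this]
  · rintro t' σ' ⟨ht', hL, hR, hC, hF, hreg'⟩
    refine ⟨by omega, hL, hR, hC, fun x hx h1 h2 => ?_, fun j hj => ?_⟩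
    · rw [hF x hx h1 h2, State.mem_setMem, if_neg (by omega)]
      exact hm₁ x hx
    · rw [hreg' j (by omega)]
      simp only [State.reg_setReg, State.reg_setMem]
      rw [if_neg (by omega), if_neg (by omega), if_neg (by omega), if_neg (by omega),
        hreg₁ j (by omega)]

end

end RangeMedian

/-! ### The lazily built tree, its potential, and the search. -/

namespace RangeMedian

/-- The nodes of the balanced tree over the ranks `0, …, n - 1`, by depth and interval of ranks. -/
inductive IsNode (n : ℕ) : ℕ → ℕ → ℕ → Prop
  | root : IsNode n 0 0 n
  | left {d a b : ℕ} (h : IsNode n d a b) (h2 : a + 2 ≤ b) : IsNode n (d + 1) a ((a + b) / 2)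
  | right {d a b : ℕ} (h : IsNode n d a b) (h2 : a + 2 ≤ b) : IsNode n (d + 1) ((a + b) / 2) b

/-- The memory represents a partially built tree: every inner node is either untouched, or its
counts and the positions at its children are available. -/
structure TreeInv (K : ℕ → ℕ) (n : ℕ) (μ : ℕ → ℕ) : Prop where
  root : Present K n μ 0 0 n
  node : ∀ {d a b}, IsNode n d a b → a + 2 ≤ b →
    (∀ i ≤ b - a, μ (4 * n * d + (n + 2 * a + i)) = 0) ∨
    (Counted K n μ d a b ((a + b) / 2) ∧ Present K n μ (d + 1) a ((a + b) / 2) ∧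
      Present K n μ (d + 1) ((a + b) / 2) b)

/-- The number of cells for counts at depth less than `D` that have not been written. -/
def potential (n D : ℕ) (μ : ℕ → ℕ) : ℕ :=
  ((Finset.range D ×ˢ Finset.range (3 * n)).filter
    (fun p => μ (4 * n * p.1 + (n + p.2)) = 0)).card

/-- Split the node between registers `23` and `24` unless this has been done before. -/
def openNode : Stmt :=
  .op 27 .add (.reg 25) (.reg 2) ;; .op 28 .mul (.lit 2) (.reg 23) ;;
  .op 27 .add (.reg 27) (.reg 28) ;; .op 28 .add (.reg 23) (.reg 24) ;;
  .op 28 .div (.reg 28) (.lit 2) ;; .load 29 (.reg 27) ;; .cond (.reg 29) .skip split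

/-- Go to the child that contains the answer. -/
def descend : Stmt :=
  .op 29 .add (.reg 27) (.reg 20) ;; .load 29 (.reg 29) ;; .op 29 .sub (.reg 29) (.lit 1) ;;
  .op 30 .add (.reg 27) (.reg 21) ;; .load 30 (.reg 30) ;; .op 30 .sub (.reg 30) (.lit 1) ;;
  .op 31 .sub (.reg 30) (.reg 29) ;; .op 32 .lt (.reg 22) (.reg 31) ;;
  .cond (.reg 32)
    (.op 20 .add (.reg 29) (.lit 0) ;; .op 21 .add (.reg 30) (.lit 0) ;;
      .op 24 .add (.reg 28) (.lit 0))
    (.op 20 .sub (.reg 20) (.reg 29) ;; .op 21 .sub (.reg 21) (.reg 30) ;;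
      .op 22 .sub (.reg 22) (.reg 31) ;; .op 23 .add (.reg 28) (.lit 0)) ;;
  .op 25 .add (.reg 25) (.reg 3) ;; .op 26 .sub (.reg 24) (.reg 23) ;;
  .op 26 .lt (.lit 1) (.reg 26)

/-- The search is for the element of rank `p₀` among the positions `l, …, r`, and it has arrived at
the node `[a, b)` at depth `d`. -/
structure Seeks (K : ℕ → ℕ) (n l r p₀ d a b : ℕ) (σ : State) : Prop where
  reg20 : σ.reg 20 = cnt K a b l
  reg21 : σ.reg 21 = cnt K a b (r + 1)
  rank : cnt K 0 a (r + 1) + σ.reg 22 = p₀ + cnt K 0 a l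
  lt : cnt K a b l + σ.reg 22 < cnt K a b (r + 1)
  reg23 : σ.reg 23 = a
  reg24 : σ.reg 24 = b
  reg25 : σ.reg 25 = 4 * n * d

/-- The size decreases by at least one per level; hence depths stay below `n` and the levels
reserved in memory suffice. -/
theorem IsNode.bounds {n d a b : ℕ} (h : IsNode n d a b) (hn : 1 ≤ n) :
    a < b ∧ b ≤ n ∧ d + (b - a) ≤ n := by
  induction h <;> omega

/-- Size minus one is the right quantity: it is at most halved, rounding down, even for the larger
child. -/
theorem IsNode.size_le {n d a b : ℕ} (h : IsNode n d a b) :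
    b - a ≤ (n - 1) / 2 ^ d + 1 := by
  induction h with
  | root => simp; omega
  | left h h2 ih => rw [pow_succ, ← Nat.div_div_eq_div_mul]; omega
  | right h h2 ih => rw [pow_succ, ← Nat.div_div_eq_div_mul]; omega

theorem IsNode.eq_or_disjoint {n d a b a' b' : ℕ} (h : IsNode n d a b) (h' : IsNode n d a' b') :
    (a = a' ∧ b = b') ∨ b ≤ a' ∨ b' ≤ a := by
  induction h generalizing a' b' with
  | root => cases h'; simp
  | left h h2 ih =>
    cases h' with
    | left g g2 => rcases ih g with ⟨rfl, rfl⟩ | h | h <;> omega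
    | right g g2 => rcases ih g with ⟨rfl, rfl⟩ | h | h <;> omega
  | right h h2 ih =>
    cases h' with
    | left g g2 => rcases ih g with ⟨rfl, rfl⟩ | h | h <;> omega
    | right g g2 => rcases ih g with ⟨rfl, rfl⟩ | h | h <;> omega

theorem block_inj {n d e x y : ℕ} (hx : x < 4 * n) (hy : y < 4 * n)
    (h : 4 * n * d + x = 4 * n * e + y) : d = e ∧ x = y := by
  have hd : d = e := by
    have h1 := Nat.mul_add_div (show 0 < 4 * n by omega) d x
    have h2 := Nat.mul_add_div (show 0 < 4 * n by omega) e y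
    rw [Nat.div_eq_of_lt hx] at h1
    rw [Nat.div_eq_of_lt hy] at h2
    rw [h] at h1
    omega
  subst hd
  omega

/-- The frame condition in coordinates: a cell is a pair of level `e` and offset `y < 4 * n`, and
`block_inj` makes these coordinates unique. -/
theorem SplitFrame.at {n d a b e y : ℕ} {μ μ' : ℕ → ℕ} (h : SplitFrame n d a b μ μ')
    (hab : a < b) (hb : b ≤ n) (he : e < n + 2) (hy : y < 4 * n)
    (h1 : e = d + 1 → ¬ (a ≤ y ∧ y < b)) (h2 : e = d → ¬ (n + 2 * a ≤ y ∧ y ≤ n + a + b)) :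
    μ' (4 * n * e + y) = μ (4 * n * e + y) := by
  refine h _ ?_ ?_ ?_
  · have : 4 * n * (e + 1) ≤ 4 * n * (n + 2) := Nat.mul_le_mul_left _ (by omega)
    have h' : 4 * n * (e + 1) = 4 * n * e + 4 * n := by ring
    omega
  · rintro ⟨h3, h4⟩
    obtain ⟨z, hz⟩ := Nat.exists_eq_add_of_le h3
    obtain ⟨h5, h6⟩ := block_inj hy (show a + z < 4 * n by omega)
      (show 4 * n * e + y = 4 * n * (d + 1) + (a + z) by omega)
    exact h1 h5 (by omega)
  · rintro ⟨h3, h4⟩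
    obtain ⟨z, hz⟩ := Nat.exists_eq_add_of_le h3
    obtain ⟨h5, h6⟩ := block_inj hy (show n + 2 * a + z < 4 * n by omega)
      (show 4 * n * e + y = 4 * n * d + (n + 2 * a + z) by omega)
    exact h2 h5 (by omega)

section
variable {α : Type*} [LinearOrder α] {n : ℕ} {W : ℕ} {procs : List Stmt} {S : Fin n → α}
  {K : ℕ → ℕ}

theorem Present.congr (hK : IsRank S K) {μ μ' : ℕ → ℕ} {d a b : ℕ} (h : Present K n μ d a b)
    (hb : b ≤ n) (hμ : ∀ y, a ≤ y → y < b → μ' (4 * n * d + y) = μ (4 * n * d + y)) :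
    Present K n μ' d a b := by
  intro x hx hxa hxb
  have h1 := cnt_lt_cnt hxa hxb hx
  rw [cnt_n hK hb] at h1
  rw [hμ _ (by omega) (by omega), h x hx hxa hxb]

/-- Distinct nodes of one level have disjoint intervals, so their children occupy disjoint cells.
Their count cells are disjoint too: for `a < b ≤ a'` the last offset `n + a + b` of one node is less
than the first offset `n + 2 * a'` of the other. -/
theorem TreeInv.split (hK : IsRank S K) {μ μ' : ℕ → ℕ} (h : TreeInv K n μ) {d a b : ℕ}
    (hn : 1 ≤ n) (hN : IsNode n d a b) (hab : a + 2 ≤ b) (hF : SplitFrame n d a b μ μ')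
    (hC : Counted K n μ' d a b ((a + b) / 2)) (hL : Present K n μ' (d + 1) a ((a + b) / 2))
    (hR : Present K n μ' (d + 1) ((a + b) / 2) b) : TreeInv K n μ' := by
  have hB := hN.bounds hn
  refine ⟨h.root.congr hK le_rfl fun y _ hy => hF.at (by omega) hB.2.1 (by omega) (by omega)
    (by omega) (by omega), ?_⟩
  intro e a' b' hN' hab'
  have hB' := hN'.bounds hn
  by_cases hsame : e = d ∧ a = a' ∧ b = b'
  · obtain ⟨rfl, rfl, rfl⟩ := hsame
    exact Or.inr ⟨hC, hL, hR⟩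
  have hdisj : e = d → b ≤ a' ∨ b' ≤ a := by
    rintro rfl
    have := hN.eq_or_disjoint hN'
    tauto
  have hcell : ∀ i ≤ b' - a', μ' (4 * n * e + (n + 2 * a' + i)) =
      μ (4 * n * e + (n + 2 * a' + i)) := fun i hi =>
    hF.at (by omega) hB.2.1 (by omega) (by omega) (by omega) (fun hed => by
      have := hdisj hed
      omega)
  have hchild : ∀ y, a' ≤ y → y < b' → μ' (4 * n * (e + 1) + y) = μ (4 * n * (e + 1) + y) :=
    fun y h1 h2 => hF.at (by omega) hB.2.1 (by omega) (by omega)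
      (fun hed => by
        have := hdisj (by omega)
        omega) (by omega)
  rcases h.node hN' hab' with h0 | ⟨h1, h2, h3⟩
  · exact Or.inl fun i hi => by rw [hcell i hi, h0 i hi]
  · refine Or.inr ⟨fun x hx => ?_, h2.congr hK (by omega) fun y hy hy' => hchild y hy (by omega),
      h3.congr hK hB'.2.1 fun y hy hy' => hchild y (by omega) hy'⟩
    have hle := cnt_mono (K := K) a' b' hx
    rw [cnt_n hK hB'.2.1] at hle
    have := h1 x hx
    rw [show ∀ z, 4 * n * e + n + 2 * a' + z = 4 * n * e + (n + 2 * a' + z) by intros; ring] at this ⊢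
    rw [hcell _ hle, this]

/-- Splitting fills zero count cells of the node with nonzero values and changes no other count
cell. One more cell is filled than the bound uses. -/
theorem potential_split (hK : IsRank S K) {μ μ' : ℕ → ℕ} {d a b m D : ℕ} (hab : a < b)
    (hb : b ≤ n) (hD : D ≤ n) (hF : SplitFrame n d a b μ μ') (hC : Counted K n μ' d a b m)
    (h0 : ∀ i ≤ b - a, μ (4 * n * d + (n + 2 * a + i)) = 0) :
    potential n D μ' + (if d < D then b - a else 0) ≤ potential n D μ := by
  have hne : ∀ i ≤ b - a, μ' (4 * n * d + (n + (2 * a + i))) ≠ 0 := by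
    intro i hi
    -- `Counted` speaks of prefixes of the array, so each index must be realized by some prefix; the
    -- last index is realized by the whole array.
    obtain ⟨x, hx, rfl⟩ : ∃ x ≤ n, cnt K a b x = i := by
      rcases hi.lt_or_eq with hi | rfl
      · obtain ⟨x, hx, _, _, h⟩ := exists_cnt_eq (K := K) (a := a) (b := b) (i := i) (N := n)
          (by rw [cnt_n hK hb]; exact hi)
        exact ⟨x, hx.le, h⟩
      · exact ⟨n, le_rfl, cnt_n hK hb⟩
    have := hC x hx
    rw [← add_assoc, ← add_assoc, this]
    omega
  let T : Finset (ℕ × ℕ) :=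
    if d < D then (Finset.range (b - a)).image (fun i => (d, 2 * a + i)) else ∅
  have hT : T.card = if d < D then b - a else 0 := by
    by_cases hd : d < D
    · simp only [T, if_pos hd]
      rw [Finset.card_image_of_injective _ (fun i j hij => by simpa using hij), Finset.card_range]
    · simp [T, if_neg hd]
  have hTmem : ∀ p ∈ T, d < D ∧ ∃ i < b - a, p = (d, 2 * a + i) := by
    intro p hp
    by_cases hd : d < D
    · simp only [T, if_pos hd, Finset.mem_image, Finset.mem_range] at hp
      obtain ⟨i, hi, rfl⟩ := hp
      exact ⟨hd, i, hi, rfl⟩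
    · simp [T, if_neg hd] at hp
  rw [← hT, potential, potential, ← Finset.card_union_of_disjoint]
  · refine Finset.card_le_card fun p hp => ?_
    rcases Finset.mem_union.1 hp with hp | hp
    · obtain ⟨e, y⟩ := p
      simp only [Finset.mem_filter, Finset.mem_product, Finset.mem_range] at hp ⊢
      obtain ⟨⟨he, hy⟩, hz⟩ := hp
      refine ⟨⟨he, hy⟩, ?_⟩
      rw [← hF.at hab hb (by omega) (by omega) (by omega), hz]
      rintro rfl ⟨h1, h2⟩
      obtain ⟨i, rfl⟩ := Nat.exists_eq_add_of_le (show 2 * a ≤ y by omega)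
      exact hne i (by omega) hz
    · obtain ⟨hd, i, hi, rfl⟩ := hTmem p hp
      simp only [Finset.mem_filter, Finset.mem_product, Finset.mem_range]
      refine ⟨⟨hd, by omega⟩, ?_⟩
      rw [← h0 i hi.le]
      congr 1
      ring
  · refine Finset.disjoint_left.2 fun p hp hp' => ?_
    obtain ⟨hd, i, hi, rfl⟩ := hTmem p hp'
    exact hne i hi.le (Finset.mem_filter.1 hp).2

/-- Amortized cost: the `2017` steps per element of a split are taken from the potential at depth
less than `D` and charged to the query otherwise. -/
theorem run_openNode (hK : IsRank S K) (hp : procs[0]? = some select) {σ : State} {d a b D : ℕ}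
    (hn : 1 ≤ n) (hD : D ≤ n) (hE : Env n W σ) (hI : TreeInv K n σ.mem) (hN : IsNode n d a b)
    (hab : a + 2 ≤ b) (h23 : σ.reg 23 = a) (h24 : σ.reg 24 = b) (h25 : σ.reg 25 = 4 * n * d)
    (hP : Present K n σ.mem d a b) :
    Run W procs S openNode σ (fun t σ' =>
      t + 2017 * potential n D σ'.mem ≤
        2017 * potential n D σ.mem + 2017 * (if d < D then 0 else b - a) + 20 ∧
      TreeInv K n σ'.mem ∧ Present K n σ'.mem (d + 1) a ((a + b) / 2) ∧
      Present K n σ'.mem (d + 1) ((a + b) / 2) b ∧ Counted K n σ'.mem d a b ((a + b) / 2) ∧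
      σ'.reg 27 = 4 * n * d + n + 2 * a ∧ σ'.reg 28 = (a + b) / 2 ∧
      ∀ j, j < 5 ∨ 20 ≤ j ∧ j < 27 → σ'.reg j = σ.reg j) := by
  have hB := hN.bounds hn
  have hE' := hE
  obtain ⟨h2, h3, h4, hW, hW'⟩ := hE'
  have hZ : 4 * n * d + 8 * n ≤ 4 * n * (n + 2) := by
    have : 4 * n * (d + 2) ≤ 4 * n * (n + 2) := Nat.mul_le_mul_left _ (by omega)
    have hP2 : 4 * n * (d + 2) = 4 * n * d + 8 * n := by ring
    omega
  rw [openNode]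
  refine run_op_seq (4 * n * d + n) (by simp [h25, h2]) (by omega) ?_
  refine run_op_seq (2 * a) (by simp [h23]) (by omega) ?_
  refine run_op_seq (4 * n * d + n + 2 * a) (by simp) (by omega) ?_
  refine run_op_seq (a + b) (by simp [h23, h24]) (by omega) ?_
  refine run_op_seq ((a + b) / 2) (by simp) (by omega) ?_
  refine run_load_seq (σ.mem (4 * n * d + n + 2 * a)) (by simp) ?_
  rw [run_cond]
  have hregs : ∀ j, j < 5 ∨ 20 ≤ j ∧ j < 27 → ∀ v₁ v₂ v₃ v₄ v₅ v₆,
      ((((((σ.setReg 27 v₁).setReg 28 v₂).setReg 27 v₃).setReg 28 v₄).setReg 28 v₅).setReg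
        29 v₆).reg j = σ.reg j := by
    intro j hj v₁ v₂ v₃ v₄ v₅ v₆
    simp [show j ≠ 27 by omega, show j ≠ 28 by omega, show j ≠ 29 by omega]
  constructor
  · intro hne
    simp only [Operand.eval, State.reg_setReg, if_true] at hne
    rcases hI.node hN hab with h0 | ⟨h5, h6, h7⟩
    · exact absurd (by simpa [add_assoc] using h0 0 (by omega)) hne
    · rw [run_skip]
      simp only [State.mem_setReg]
      refine ⟨by omega, hI, h6, h7, h5, by simp, by simp, fun j hj => hregs j hj _ _ _ _ _ _⟩
  · intro heq
    simp only [Operand.eval, State.reg_setReg, if_true] at heq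
    rcases hI.node hN hab with h0 | ⟨h5, h6, h7⟩
    · refine (run_split hK hp (d := d) (a := a) (b := b) (m := (a + b) / 2) ?_ ?_ (by omega)
        (by omega) hB.2.1 (by omega) (by simpa using hP)).mono ?_
      · constructor
        · simp [h2]
        · simp [h3]
        · simp [h4]
        · exact hW
        · exact hW'
      · constructor <;> simp [h23, h24, h25]
      · rintro t σ' ⟨ht, hL, hR, hC, hF, hreg⟩
        simp only [State.mem_setReg] at hF
        have hpot := potential_split (D := D) hK hB.1 hB.2.1 hD hF hC h0
        refine ⟨?_, hI.split hK hn hN hab hF hC hL hR, hL, hR, hC, ?_, ?_, fun j hj => ?_⟩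
        · split_ifs at hpot ⊢ <;> omega
        · rw [hreg 27 (by omega)]; simp
        · rw [hreg 28 (by omega)]; simp
        · rw [hreg j (by omega), hregs j hj]
    -- In a split node the first count cell is `1`, which contradicts the test.
    · have := h5 0 (by omega)
      rw [cnt_zero, cnt_zero] at this
      simp [heq] at this

/-- The difference of the two left counts is the number of queried positions in the left child. If
the remaining rank is smaller, the search goes left; otherwise that number is subtracted and the
search goes right, where by `cnt_add` the counts are differences. -/
theorem run_descend {σ : State} {l r p₀ d a b m : ℕ}
    (h3 : σ.reg 3 = 4 * n) (hq : Seeks K n l r p₀ d a b σ) (h27 : σ.reg 27 = 4 * n * d + n + 2 * a)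
    (h28 : σ.reg 28 = m) (hC : Counted K n σ.mem d a b m) (ham : a ≤ m) (hmb : m ≤ b)
    (hl : l ≤ r) (hr : r < n) (hb : b ≤ n) (hcb : ∀ x ≤ n, cnt K a b x ≤ b - a)
    (hW : 4 * n * d + 8 * n ≤ W) (hW' : 1 ≤ W) :
    Run W procs S descend σ (fun t σ' => t ≤ 20 ∧ σ'.mem = σ.mem ∧
      (∃ a' b', (a' = a ∧ b' = m ∨ a' = m ∧ b' = b) ∧ Seeks K n l r p₀ (d + 1) a' b' σ' ∧
        σ'.reg 26 = if 1 < b' - a' then 1 else 0) ∧ ∀ j < 5, σ'.reg j = σ.reg j) := by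
  obtain ⟨h20, h21, hrank, hlt, h23, h24, h25⟩ := hq
  have hCl := hC l (by omega)
  have hCr := hC (r + 1) hr
  have hl1 := hcb l (by omega)
  have hr1 := hcb (r + 1) hr
  have hal := cnt_add (K := K) ham hmb l
  have har := cnt_add (K := K) ham hmb (r + 1)
  have hzl := cnt_add (K := K) (Nat.zero_le a) ham l
  have hzr := cnt_add (K := K) (Nat.zero_le a) ham (r + 1)
  have hmono1 := cnt_mono (K := K) a m (show l ≤ r + 1 by omega)
  have hmono2 := cnt_mono (K := K) m b (show l ≤ r + 1 by omega)
  have hP1 : 4 * n * (d + 1) = 4 * n * d + 4 * n := by ring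
  rw [descend]
  refine run_op_seq (4 * n * d + n + 2 * a + cnt K a b l) (by simp [h27, h20]) (by omega) ?_
  refine run_load_seq (cnt K a m l + 1) (by simp [hCl]) ?_
  refine run_op_seq (cnt K a m l) (by simp) (by omega) ?_
  refine run_op_seq (4 * n * d + n + 2 * a + cnt K a b (r + 1)) (by simp [h27, h21]) (by omega) ?_
  refine run_load_seq (cnt K a m (r + 1) + 1) (by simp [hCr]) ?_
  refine run_op_seq (cnt K a m (r + 1)) (by simp) (by omega) ?_
  refine run_op_seq (cnt K a m (r + 1) - cnt K a m l) (by simp) (by omega) ?_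
  refine run_op_seq (if σ.reg 22 < cnt K a m (r + 1) - cnt K a m l then 1 else 0) (by simp)
    (ite_one_zero_le hW') ?_
  by_cases hside : σ.reg 22 < cnt K a m (r + 1) - cnt K a m l
  · refine run_cond_seq_true (by simp [hside]) ?_
    refine run_seq_assoc (run_op_seq (cnt K a m l) (by simp) (by omega) ?_)
    refine run_seq_assoc (run_op_seq (cnt K a m (r + 1)) (by simp) (by omega) ?_)
    refine run_op_seq m (by simp [h28]) (by omega) ?_
    refine run_op_seq (4 * n * d + 4 * n) (by simp [h25, h3]) (by omega) ?_
    refine run_op_seq (m - a) (by simp [h23]) (by omega) ?_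
    refine run_op.2 ⟨by simpa using ite_one_zero_le hW', by omega, by simp,
      ⟨a, m, Or.inl ⟨rfl, rfl⟩, ?_, by simp⟩, fun j hj => ?_⟩
    · constructor <;> simp [h23, hP1] <;> omega
    · simp [show j ≠ 26 by omega, show j ≠ 25 by omega, show j ≠ 24 by omega,
        show j ≠ 21 by omega, show j ≠ 20 by omega, show j ≠ 32 by omega,
        show j ≠ 31 by omega, show j ≠ 30 by omega, show j ≠ 29 by omega]
  · refine run_cond_seq_false (by simp [hside]) ?_
    refine run_seq_assoc (run_op_seq (cnt K m b l) (by simp [h20]; omega) (by omega) ?_)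
    refine run_seq_assoc (run_op_seq (cnt K m b (r + 1)) (by simp [h21]; omega) (by omega) ?_)
    refine run_seq_assoc (run_op_seq (σ.reg 22 - (cnt K a m (r + 1) - cnt K a m l)) (by simp)
      (by omega) ?_)
    refine run_op_seq m (by simp [h28]) (by omega) ?_
    refine run_op_seq (4 * n * d + 4 * n) (by simp [h25, h3]) (by omega) ?_
    refine run_op_seq (b - m) (by simp [h24]) (by omega) ?_
    refine run_op.2 ⟨by simpa using ite_one_zero_le hW', by omega, by simp,
      ⟨m, b, Or.inr ⟨rfl, rfl⟩, ?_, by simp⟩, fun j hj => ?_⟩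
    · constructor <;> simp [h24, hP1] <;> omega
    · simp [show j ≠ 26 by omega, show j ≠ 25 by omega, show j ≠ 23 by omega,
        show j ≠ 22 by omega, show j ≠ 21 by omega, show j ≠ 20 by omega, show j ≠ 32 by omega,
        show j ≠ 31 by omega, show j ≠ 30 by omega, show j ≠ 29 by omega]

/-- Descend from the root to a leaf. -/
theorem run_search (hK : IsRank S K) (hp : procs[0]? = some select) {l r p₀ D : ℕ} (hn : 1 ≤ n)
    (hD : D ≤ n) (hl : l ≤ r) (hr : r < n) (ℓ : ℕ) :
    ∀ {σ : State} {d a b : ℕ}, (n - 1) / 2 ^ d < 2 ^ ℓ → Env n W σ → TreeInv K n σ.mem →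
      IsNode n d a b → Present K n σ.mem d a b → Seeks K n l r p₀ d a b σ →
      (σ.reg 26 = if 1 < b - a then 1 else 0) →
      Run W procs S (.loop (.reg 26) (openNode ;; descend)) σ (fun t σ' =>
        t + 2017 * potential n D σ'.mem ≤ 2017 * potential n D σ.mem +
          2017 * (2 * ((n - 1) / 2 ^ max d D)) + 2100 * ℓ + 1 ∧
        Env n W σ' ∧ TreeInv K n σ'.mem ∧ ∃ d' a' , a' < n ∧ d' < n ∧
          Present K n σ'.mem d' a' (a' + 1) ∧ Seeks K n l r p₀ d' a' (a' + 1) σ') := by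
  induction ℓ with
  | zero =>
    intro σ d a b hℓ hE hI hN hP hq h26
    have hs := hN.size_le
    have hB := hN.bounds hn
    -- Here `(n - 1) / 2 ^ d = 0`, so the node consists of a single rank.
    rw [pow_zero] at hℓ
    refine run_loop_exit (by simp [h26]; omega) ⟨by omega, hE, hI, d, a, by omega, by omega, ?_⟩
    obtain rfl : b = a + 1 := by omega
    exact ⟨hP, hq⟩
  | succ ℓ ih =>
    intro σ d a b hℓ hE hI hN hP hq h26
    have hs := hN.size_le
    have hB := hN.bounds hn
    by_cases hab : a + 2 ≤ b
    · refine run_loop_step (by simp [h26]; omega) ?_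
      rw [run_seq]
      refine (run_openNode hK hp hn hD hE hI hN hab hq.reg23 hq.reg24 hq.reg25 hP).mono ?_
      rintro t₁ σ₁ ⟨ht₁, hI₁, hL, hR, hC, h27, h28, hreg₁⟩
      have hE' := hE
      obtain ⟨h2, h3, h4, hW, hW'⟩ := hE'
      have hZ : 4 * n * d + 8 * n ≤ 4 * n * (n + 2) := by
        have : 4 * n * (d + 2) ≤ 4 * n * (n + 2) := Nat.mul_le_mul_left _ (by omega)
        have hP2 : 4 * n * (d + 2) = 4 * n * d + 8 * n := by ring
        omega
      have hq₁ : Seeks K n l r p₀ d a b σ₁ := by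
        obtain ⟨g20, g21, g22, g22', g23, g24, g25⟩ := hq
        constructor
        · rw [hreg₁ 20 (by omega), g20]
        · rw [hreg₁ 21 (by omega), g21]
        · rw [hreg₁ 22 (by omega), g22]
        · rw [hreg₁ 22 (by omega)]; exact g22'
        · rw [hreg₁ 23 (by omega), g23]
        · rw [hreg₁ 24 (by omega), g24]
        · rw [hreg₁ 25 (by omega), g25]
      refine (run_descend (by rw [hreg₁ 3 (by omega), h3]) hq₁ h27 h28 hC (by omega) (by omega) hl
        hr hB.2.1 (fun x hx => ?_) (by omega) (by omega)).mono ?_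
      · rw [← cnt_n hK hB.2.1]
        exact cnt_mono a b hx
      rintro t₂ σ₂ ⟨ht₂, hm₂, ⟨a', b', hab', hq₂, h26₂⟩, hreg₂⟩
      have hnode : IsNode n (d + 1) a' b' ∧ Present K n σ₂.mem (d + 1) a' b' := by
        rw [hm₂]
        rcases hab' with ⟨rfl, rfl⟩ | ⟨rfl, rfl⟩
        · exact ⟨hN.left hab, hL⟩
        · exact ⟨hN.right hab, hR⟩
      have hE₂ : Env n W σ₂ := by
        constructor
        · rw [hreg₂ 2 (by omega), hreg₁ 2 (by omega), h2]
        · rw [hreg₂ 3 (by omega), hreg₁ 3 (by omega), h3]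
        · rw [hreg₂ 4 (by omega), hreg₁ 4 (by omega), h4]
        · exact hW
        · exact hW'
      have hhalf : (n - 1) / 2 ^ (d + 1) = (n - 1) / 2 ^ d / 2 := by
        rw [pow_succ, Nat.div_div_eq_div_mul]
      refine (ih (by rw [hhalf]; rw [pow_succ] at hℓ; omega) hE₂ (by rw [hm₂]; exact hI₁) hnode.1
        hnode.2 hq₂ h26₂).mono ?_
      rintro t₃ σ₃ ⟨ht₃, hrest⟩
      refine ⟨?_, hrest⟩
      rw [hm₂] at ht₃
      -- Above depth `D` the potential pays. From there on, with `x = (n - 1) / 2 ^ d`, a split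
      -- costs at most `2017 * (x + 1)`, and `x + 2 * (x / 2) ≤ 2 * x` sums the geometric series;
      -- the extra `2017` and the constant work fit into `2100` per level.
      by_cases hdD : d < D
      · rw [if_pos hdD] at ht₁
        rw [max_eq_right (by omega)] at ht₃ ⊢
        omega
      · rw [if_neg hdD] at ht₁
        rw [max_eq_left (by omega)] at ht₃ ⊢
        rw [hhalf] at ht₃
        omega
    · refine run_loop_exit (by simp [h26]; omega) ⟨by omega, hE, hI, d, a, by omega, by omega, ?_⟩
      obtain rfl : b = a + 1 := by omega
      exact ⟨hP, hq⟩

end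

end RangeMedian

/-! ### The online algorithm and its total cost. -/

namespace RangeMedian

/-- Set up the constants and the root of the tree. -/
def preprocess : Stmt :=
  .op 2 .add (.reg 0) (.lit 0) ;; .op 3 .mul (.lit 4) (.reg 0) ;; .op 4 .add (.reg 0) (.lit 2) ;;
  .op 4 .mul (.reg 3) (.reg 4) ;;
  .loop (.reg 0) (.op 0 .sub (.reg 0) (.lit 1) ;; .store (.reg 0) (.reg 0))

/-- Answer the query in registers `0` and `1`. -/
def answer : Stmt :=
  .op 20 .add (.reg 0) (.lit 0) ;; .op 21 .add (.reg 1) (.lit 1) ;; .op 22 .sub (.reg 1) (.reg 0) ;;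
  .op 22 .div (.reg 22) (.lit 2) ;; .op 23 .add (.lit 0) (.lit 0) ;;
  .op 24 .add (.reg 2) (.lit 0) ;; .op 25 .add (.lit 0) (.lit 0) ;; .op 26 .lt (.lit 1) (.reg 24) ;;
  .loop (.reg 26) (openNode ;; descend) ;; .op 27 .add (.reg 25) (.reg 23) ;; .load 0 (.reg 27)

/-- Range medians with a lazily built balanced tree over the ranks. -/
def lazyTree : OnlineAlgorithm := ⟨[select], preprocess, answer⟩

section
variable {α : Type*} [LinearOrder α] {n : ℕ} {W : ℕ} {procs : List Stmt} {S : Fin n → α}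
  {K : ℕ → ℕ}

theorem cnt_all (hK : IsRank S K) {x : ℕ} (hx : x ≤ n) : cnt K 0 n x = x := by
  induction x with
  | zero => exact cnt_zero _ _
  | succ x ih =>
    rw [cnt_succ, ih (by omega), if_pos ⟨Nat.zero_le _, hK.bijOn.mapsTo (show x ∈ Set.Iio n from hx)⟩]

theorem cnt_self (a x : ℕ) : cnt K a a x = 0 := by
  induction x with
  | zero => exact cnt_zero _ _
  | succ x ih => rw [cnt_succ, ih, if_neg (by omega)]

theorem cnt_eq_add_card (a b l N : ℕ) (h : l ≤ N) :
    cnt K a b N = cnt K a b l + ((Finset.Ico l N).filter (fun y => a ≤ K y ∧ K y < b)).card := by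
  induction N, h using Nat.le_induction with
  | base => simp
  | succ N h ih =>
    rw [cnt_succ, ih, Finset.card_filter, Finset.card_filter, Finset.sum_Ico_succ_top h, add_assoc]

/-- The zero-based rank sought is `(r - l) / 2`, so the median has `(r - l) / 2 + 1` queried
elements up to and including itself; this equals half of `(r - l + 1) + 1`, rounded down. -/
theorem isAnswer_of_cnt (hS : Function.Injective S) (hK : IsRank S K) (q : Query n) {x : Fin n}
    (hl : q.l ≤ x) (hr : x ≤ q.r)
    (hx : cnt K 0 (K x + 1) (q.r + 1) = cnt K 0 (K x + 1) q.l + ((q.r - q.l : ℕ) / 2 + 1)) :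
    IsAnswer S q x := by
  refine ⟨x.2, Finset.mem_image_of_mem _ (Finset.mem_Icc.2 ⟨hl, hr⟩), ?_⟩
  have hle : (q.l : ℕ) ≤ q.r := q.le
  rw [Finset.filter_image, Finset.card_image_of_injective _ hS, Finset.card_image_of_injective _ hS,
    Fin.card_Icc]
  rw [cnt_eq_add_card 0 (K x + 1) q.l (q.r + 1) (by omega)] at hx
  have : ((Finset.Icc q.l q.r).filter (fun y => S y ≤ S x)).card =
      ((Finset.Ico (q.l : ℕ) (q.r + 1)).filter (fun y => 0 ≤ K y ∧ K y < K x + 1)).card := by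
    have hiff : ∀ y : Fin n, S y ≤ S x ↔ K y < K x + 1 := fun y => by
      rw [← not_lt, hK.lt_iff]
      omega
    refine Finset.card_nbij (fun y : Fin n => (y : ℕ)) ?_ ?_ ?_
    · intro y hy
      obtain ⟨h1, h2⟩ := Finset.mem_filter.1 hy
      simp only [Finset.mem_Icc, Fin.le_def, hiff] at h1 h2
      exact Finset.mem_coe.2 (Finset.mem_filter.2
        ⟨Finset.mem_Ico.2 ⟨h1.1, Nat.lt_succ_of_le h1.2⟩, Nat.zero_le _, h2⟩)
    · exact fun y _ z _ h => Fin.ext h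
    · intro y hy
      simp only [Finset.coe_filter, Finset.mem_Ico, Set.mem_ofPred_eq] at hy
      refine ⟨⟨y, by omega⟩, ?_, rfl⟩
      simp only [Finset.coe_filter, Finset.mem_Icc, Fin.le_def, hiff, Set.mem_ofPred_eq]
      omega
  rw [this]
  omega

theorem run_preprocess (hK : IsRank S K) (hn : 1 ≤ n)
    (hW : 4 * n * (n + 2) + (n + 1) * (4 * n) ≤ W) (hW' : 16 ≤ W) :
    Run W procs S preprocess (startState n) (fun t σ' => t ≤ 3 * n + 5 ∧ Env n W σ' ∧
      TreeInv K n σ'.mem) := by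
  have hZ : 4 * n * 3 ≤ 4 * n * (n + 2) := Nat.mul_le_mul_left _ (by omega)
  have h0 : (startState n).reg 0 = n := by simp [startState]
  have hm0 : ∀ y, (startState n).mem y = 0 := fun y => by simp [startState]
  rw [preprocess]
  refine run_op_seq n (by simp [h0]) (by omega) ?_
  refine run_op_seq (4 * n) (by simp [h0]) (by omega) ?_
  refine run_op_seq (n + 2) (by simp [h0]) (by omega) ?_
  refine run_op_seq (4 * n * (n + 2)) (by simp) (by omega) ?_
  let Inv : ℕ → State → Prop := fun i σ' => i ≤ n ∧ (∀ y, i ≤ y → y < n → σ'.mem y = y) ∧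
    (∀ y, n ≤ y → σ'.mem y = 0) ∧ σ'.reg 2 = n ∧ σ'.reg 3 = 4 * n ∧ σ'.reg 4 = 4 * n * (n + 2)
  refine (run_countdown Inv 2 ?_ (m := n) (by simp [h0]) ⟨le_rfl, by omega, by simp [hm0], by simp,
    by simp, by simp⟩).mono ?_
  · rintro i τ hi ⟨hin, h1, h2, h3, h4, h5⟩
    refine run_op_seq i (by simp [hi]) (by omega) ?_
    refine run_store.2 ⟨by simp; omega, by simp; omega, by omega, by simp, by omega, fun y hy hyn => ?_,
      fun y hy => ?_, by simp [h3], by simp [h4], by simp [h5]⟩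
    · by_cases hyi : y = i
      · simp [hyi]
      · simp [hyi, h1 y (by omega) hyn]
    · simp [show y ≠ i by omega, h2 y hy]
  · rintro t σ' ⟨ht, _, _, h1, h2, h3, h4, h5⟩
    -- The root lists all positions, so cell `x` holds `x`; all cells from `n` on are still zero, so
    -- every node is untouched.
    refine ⟨by omega, ⟨h3, h4, h5, hW, hW'⟩, fun x hx _ _ => ?_, fun _ _ => Or.inl fun i _ => ?_⟩
    · rw [cnt_all hK hx.le]
      simpa using h1 x (by omega) hx
    · exact h2 _ (by omega)

theorem run_answer (hS : Function.Injective S) (hK : IsRank S K) (hp : procs[0]? = some select)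
    {σ : State} {D : ℕ} (hD : D ≤ n) (hE : Env n W σ) (hI : TreeInv K n σ.mem) (q : Query n) :
    Run W procs S answer ((σ.setReg 0 q.l).setReg 1 q.r) (fun t σ' =>
      t + 2017 * potential n D σ'.mem ≤ 2017 * potential n D σ.mem +
        (4034 * ((n - 1) / 2 ^ D) + 2100 * Nat.clog 2 n + 20) ∧
      Env n W σ' ∧ TreeInv K n σ'.mem ∧ IsAnswer S q (σ'.reg 0)) := by
  have hlr : (q.l : ℕ) ≤ q.r := q.le
  have hrn : (q.r : ℕ) < n := q.r.2
  obtain ⟨h2, h3, h4, hW, hW'⟩ := hE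
  have hZ : 4 * n * 3 ≤ 4 * n * (n + 2) := Nat.mul_le_mul_left _ (by omega)
  rw [answer]
  refine run_op_seq q.l (by simp) (by omega) ?_
  refine run_op_seq (q.r + 1) (by simp) (by omega) ?_
  refine run_op_seq (q.r - q.l) (by simp) (by omega) ?_
  refine run_op_seq ((q.r - q.l) / 2) (by simp) (by omega) ?_
  refine run_op_seq 0 (by simp) (by omega) ?_
  refine run_op_seq n (by simp [h2]) (by omega) ?_
  refine run_op_seq 0 (by simp) (by omega) ?_
  refine run_op_seq (if 1 < n then 1 else 0) (by simp) (ite_one_zero_le (by omega)) ?_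
  rw [run_seq]
  refine (run_search hK hp (l := q.l) (r := q.r) (p₀ := (q.r - q.l) / 2) (D := D) (d := 0) (a := 0)
    (b := n) (by omega) hD hlr hrn (Nat.clog 2 n) ?_ ?_ (by simpa using hI) .root
    (by simpa using hI.root) ?_ (by simp)).mono ?_
  · have := Nat.le_pow_clog (b := 2) (by norm_num) n
    simp
    omega
  · constructor
    · simp [h2]
    · simp [h3]
    · simp [h4]
    · exact hW
    · exact hW'
  · constructor
    · simp [cnt_all hK q.l.2.le]
    · simp [cnt_all hK (show (q.r : ℕ) + 1 ≤ n by omega)]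
    · simp [cnt_self]
    · simp [cnt_all hK q.l.2.le, cnt_all hK (show (q.r : ℕ) + 1 ≤ n by omega)]
      omega
    · simp
    · simp
    · simp
  · rintro t τ ⟨ht, hE', hI', d, a, ha, hd, hP, hq⟩
    have hZ' : 4 * n * (d + 1) ≤ 4 * n * (n + 2) := Nat.mul_le_mul_left _ (by omega)
    rw [show 4 * n * (d + 1) = 4 * n * d + 4 * n by ring] at hZ'
    refine run_op_seq (4 * n * d + a) (by simp [hq.reg23, hq.reg25]) (by omega) ?_
    rw [run_load]
    have hlt := hq.lt
    have hrank := hq.rank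
    have hone := cnt_n hK (a := a) (b := a + 1) (by omega)
    have hm1 := cnt_mono (K := K) a (a + 1) (show (q.r : ℕ) + 1 ≤ n by omega)
    -- The leaf has exactly one position, and `hq.lt` says that it is among the queried ones; the
    -- remaining rank is therefore `0`.
    obtain ⟨x, hxr, hxa, hxa', hx0⟩ := exists_cnt_eq (K := K) (a := a) (b := a + 1) (i := 0)
      (N := q.r + 1) (by omega)
    have hxl : (q.l : ℕ) ≤ x := by
      by_contra hc
      have := cnt_lt_cnt hxa hxa' (not_le.1 hc)
      omega
    have hmem := hP x (by omega) hxa hxa'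
    rw [hx0, add_zero] at hmem
    have hKx : K x = a := by omega
    refine ⟨?_, ?_, ?_, ?_⟩
    · simp only [State.mem_setReg] at ht ⊢
      rw [max_eq_right (Nat.zero_le D)] at ht
      omega
    · obtain ⟨g2, g3, g4, _, _⟩ := hE'
      exact ⟨by simp [g2], by simp [g3], by simp [g4], hW, hW'⟩
    · simpa using hI'
    · have := isAnswer_of_cnt hS hK q (x := ⟨x, by omega⟩) hxl (by rw [Fin.le_def]; simp; omega) (by
        have h1 := cnt_add (K := K) (Nat.zero_le a) (Nat.le_succ a) q.l
        have h2 := cnt_add (K := K) (Nat.zero_le a) (Nat.le_succ a) (q.r + 1)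
        simp only [hKx]
        simp only [Nat.succ_eq_add_one] at h1 h2
        omega)
      simpa [hmem] using this

/-- The potential telescopes over the queries. The depth `D` is a free parameter of the analysis. -/
theorem exists_answers (hS : Function.Injective S) (hK : IsRank S K) {D : ℕ} (hD : D ≤ n)
    (qs : List (Query n)) {σ : State} (hE : Env n W σ) (hI : TreeInv K n σ.mem) :
    ∃ t, lazyTree.Answers W S σ qs t ∧ t ≤ 2017 * potential n D σ.mem +
      qs.length * (4034 * ((n - 1) / 2 ^ D) + 2100 * Nat.clog 2 n + 20) := by
  induction qs generalizing σ with
  | nil => exact ⟨0, .nil σ, Nat.zero_le _⟩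
  | cons q qs ih =>
    obtain ⟨t, σ', hrun, ht, hE', hI', hans⟩ :=
      run_answer (procs := lazyTree.procs) hS hK rfl hD hE hI q
    obtain ⟨t', hrest, ht'⟩ := ih hE' hI'
    refine ⟨t + t', .cons hrun hans hrest, ?_⟩
    rw [List.length_cons, Nat.succ_mul qs.length]
    omega

theorem potential_le (D : ℕ) (μ : ℕ → ℕ) : potential n D μ ≤ D * (3 * n) := by
  refine (Finset.card_filter_le _ _).trans ?_
  simp

theorem exists_solves (hS : Function.Injective S) (qs : List (Query n)) (hn : 1 ≤ n)
    (hk : 1 ≤ qs.length) :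
    ∃ t, lazyTree.Solves ((n + qs.length) ^ 8) S qs t ∧
      t ≤ 8 * n + 6051 * (n * Nat.clog 2 qs.length) + 4034 * n +
        qs.length * (2100 * Nat.clog 2 n + 20) := by
  obtain ⟨K, hK⟩ := exists_isRank hS
  obtain ⟨k, hk'⟩ : ∃ k, qs.length = k := ⟨_, rfl⟩
  rw [hk'] at hk ⊢
  have hW₀ : 64 * (n * n) ≤ (n + k) ^ 8 := by
    calc 64 * (n * n) = 2 ^ 6 * n ^ 2 := by ring
      _ ≤ (n + k) ^ 6 * (n + k) ^ 2 :=
        Nat.mul_le_mul (Nat.pow_le_pow_left (by omega) 6) (Nat.pow_le_pow_left (by omega) 2)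
      _ = (n + k) ^ 8 := by ring
  have hnn : n ≤ n * n := Nat.le_mul_of_pos_left n hn
  have hW : 4 * n * (n + 2) + (n + 1) * (4 * n) ≤ (n + k) ^ 8 := by
    rw [show 4 * n * (n + 2) + (n + 1) * (4 * n) = 8 * (n * n) + 12 * n by ring]
    omega
  obtain ⟨t₀, σ, hrun, ht₀, hE, hI⟩ :=
    run_preprocess (procs := lazyTree.procs) hK hn hW (by omega)
  -- Balances the `n * D` for the upper levels against `k * n / 2 ^ D` for the deeper ones. The cap
  -- `n` keeps the levels that define the potential inside the tree memory.
  let D := min (Nat.clog 2 k) n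
  obtain ⟨t₁, hans, ht₁⟩ := exists_answers hS hK (D := D) (min_le_right _ _) qs hE hI
  refine ⟨t₀ + t₁, ⟨σ, t₀, t₁, hrun, hans, rfl⟩, ?_⟩
  have hpot := potential_le (n := n) D σ.mem
  have hDk : D * (3 * n) ≤ 3 * (n * Nat.clog 2 k) := by
    calc D * (3 * n) ≤ Nat.clog 2 k * (3 * n) := Nat.mul_le_mul_right _ (min_le_left _ _)
      _ = 3 * (n * Nat.clog 2 k) := by ring
  -- Either `k ≤ 2 ^ D`, or `D = n` and the quotient vanishes.
  have hdeep : k * ((n - 1) / 2 ^ D) ≤ n := by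
    rcases min_choice (Nat.clog 2 k) n with h | h
    · calc k * ((n - 1) / 2 ^ D) ≤ 2 ^ D * ((n - 1) / 2 ^ D) := by
            refine Nat.mul_le_mul_right _ ?_
            simp only [D, h]
            exact Nat.le_pow_clog (by norm_num) k
        _ ≤ n - 1 := Nat.mul_div_le _ _
        _ ≤ n := Nat.sub_le _ _
    · have : (n - 1) / 2 ^ D = 0 := by
        simp only [D, h]
        exact Nat.div_eq_of_lt (lt_of_le_of_lt (Nat.sub_le _ _) Nat.lt_two_pow_self)
      rw [this]
      omega
  rw [hk', show k * (4034 * ((n - 1) / 2 ^ D) + 2100 * Nat.clog 2 n + 20) =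
    4034 * (k * ((n - 1) / 2 ^ D)) + k * (2100 * Nat.clog 2 n + 20) by ring] at ht₁
  omega

end

/-! ### From binary to natural logarithms. -/

theorem one_le_two_mul_log {m : ℕ} (hm : 1 ≤ m) : 1 ≤ 2 * Real.log (m + 1) := by
  have h1 := Real.log_two_gt_d9
  have h2 : Real.log 2 ≤ Real.log (m + 1) := by
    refine Real.log_le_log (by norm_num) ?_
    have : (1 : ℝ) ≤ m := by exact_mod_cast hm
    linarith
  linarith

theorem clog_le_four_mul_log {m : ℕ} (hm : 1 ≤ m) : (Nat.clog 2 m : ℝ) ≤ 4 * Real.log (m + 1) := by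
  have h1 := Real.log_two_gt_d9
  have h2 := one_le_two_mul_log hm
  rcases hm.lt_or_eq with hm' | rfl
  · have h3 := Nat.pow_pred_clog_lt_self (b := 2) (by norm_num) hm'
    have h4 : ((2 : ℝ) ^ (Nat.clog 2 m - 1)) ≤ m + 1 := by
      have : ((2 : ℝ) ^ (Nat.clog 2 m - 1)) < m := by exact_mod_cast h3
      linarith
    have h5 := Real.log_le_log (by positivity) h4
    rw [Real.log_pow] at h5
    have h6 : (Nat.clog 2 m : ℝ) ≤ ((Nat.clog 2 m - 1 : ℕ) : ℝ) + 1 := by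
      have : Nat.clog 2 m ≤ Nat.clog 2 m - 1 + 1 := by omega
      exact_mod_cast this
    have h7 : (0 : ℝ) ≤ ((Nat.clog 2 m - 1 : ℕ) : ℝ) := Nat.cast_nonneg _
    nlinarith
  · rw [Nat.clog_one_right]
    simp only [Nat.cast_zero]
    linarith

end RangeMedian

theorem mainTheorem3 :
    ∃ (A : RangeMedian.OnlineAlgorithm) (C : ℝ) (c : ℕ),
      ∀ (α : Type*) [LinearOrder α] (n : ℕ) (S : Fin n → α), Function.Injective S →
        ∀ (k : ℕ) (qs : List (RangeMedian.Query n)), 1 ≤ k → qs.length = k →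
          ∃ t : ℕ, A.Solves ((n + k) ^ c) S qs t ∧
            (t : ℝ) ≤ C * (n * Real.log (k + 1) + k * Real.log (k + 1) * Real.log (n + 1)) := by
  refine ⟨RangeMedian.lazyTree, 60000, 8, ?_⟩
  rintro α _ n S hS k qs hk rfl
  have hn : 1 ≤ n := by
    cases qs with
    | nil => simp at hk
    | cons q _ => exact Nat.one_le_of_lt q.l.2
  obtain ⟨t, hsol, ht⟩ := RangeMedian.exists_solves hS qs hn hk
  refine ⟨t, hsol, ?_⟩
  generalize qs.length = k at *
  have ht' : (t : ℝ) ≤ 8 * n + 6051 * (n * Nat.clog 2 k) + 4034 * n +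
      k * (2100 * Nat.clog 2 n + 20) := by exact_mod_cast ht
  have hk1 := RangeMedian.one_le_two_mul_log hk
  have hn1 := RangeMedian.one_le_two_mul_log hn
  have hk2 := RangeMedian.clog_le_four_mul_log hk
  have hn2 := RangeMedian.clog_le_four_mul_log hn
  generalize Real.log ((k : ℝ) + 1) = x at *
  generalize Real.log ((n : ℝ) + 1) = y at *
  have hn0 : (0 : ℝ) ≤ n := Nat.cast_nonneg n
  have hk0 : (0 : ℝ) ≤ k := Nat.cast_nonneg k
  have e1 : (n : ℝ) * Nat.clog 2 k ≤ n * (4 * x) := mul_le_mul_of_nonneg_left hk2 hn0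
  have e2 : (n : ℝ) * 1 ≤ n * (2 * x) := mul_le_mul_of_nonneg_left hk1 hn0
  -- `8440 = 2100 * 4 + 20 * 2`.
  have e3 : (k : ℝ) * (2100 * Nat.clog 2 n + 20) ≤ k * (8440 * y) :=
    mul_le_mul_of_nonneg_left (by linarith) hk0
  -- The proved bound has `k log n` without the factor `log (k + 1)`; that factor is at least `1 /
  -- 2` and is inserted here.
  have e4 : (k : ℝ) * (8440 * y) * 1 ≤ k * (8440 * y) * (2 * x) :=
    mul_le_mul_of_nonneg_left hk1 (mul_nonneg hk0 (by linarith))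
  have e5 : 0 ≤ (n : ℝ) * x := mul_nonneg hn0 (by linarith)
  have e6 : 0 ≤ (k : ℝ) * x * y := mul_nonneg (mul_nonneg hk0 (by linarith)) (by linarith)
  linarith
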